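/- **Proposition 3.1 (Homogeneity of contact sets).** *Notation.* Let $n\ge 1$, let $B_1$ be the open unit ball of $\mathbb R^n$ and $Q_1=B_1\times(-1,0]$. For $\theta>0$, $T>0$ put $$PB^{\theta}_{T}(x_0,t_0)=\{(x,t):\theta|x-x_0|^2\le t-t_0\le T\},\qquad PB^{-\theta}_{T}(x_0,t_0)=\{(x,t):\theta|x-x_0|^2\le t_0-t\le T\}.$$ The concave parabola of opening $a>0$ with vertex $(y,s)$ is $P_{(y,s;a)}(x,t)=-\frac a2|x-y|^2+a(t-s)$, and the convex parabola is $\frac a2|x-y|^2-a(t-s)$. For functions on $\overline B_1\times\mathbb R$, $\varphi$ *contacts* $u$ from below (above) at $(x,t)$ if $\varphi(x,t)=u(x,t)$ and $\varphi(\xi,\tau)<u(\xi,\tau)$ (respectively $>$) for all $\xi\in B_1$, $\tau<t$. For a bounded $u\in C(\overline B_1\times\mathbb R)$, the contact set $A_a(\overline Q_1)$ is the set of $(x,t)\in\overline B_1\times\mathbb R$ at which $P_{(y,s;a)}$ contacts $u-\inf_{Q_1}u$ from below for some $(y,s)\in\overline Q_1$. The function $u$ is *locally uniformly semiconcave* in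 $Q_1$ if for each compact $Z\subset Q_1$ there is $b>0$ such that at each point of $Z$ some convex parabola of opening $b$ contacts $u$ from above. Let $|\cdot|$ denote Lebesgue measure of sets, and $\|\cdot\|$ the spectral norm on the space $\mathrm{Sym}(n)$ of symmetric $n\times n$ matrices. *Hypotheses.* Let $0<\lambda\le 1\le\Lambda$, and put $$c_0=\frac{\lambda^2}{\Lambda^2(n+5)}\exp\Big\{-10^6\Big(\frac{\Lambda n}{\lambda}\Big)^2\Big\}.$$ *Statement.* There is a constant $c_1>0$ depending only on $n,\lambda,\Lambda$ such that the following holds. Let $\delta>0$ and let $F:\mathrm{Sym}(n)\to\mathbb R$ satisfy $F(0)=0$ and, for all $M$ with $\|M\|<\delta$ and all $N\ge 0$, $F(M+N)\ge F(M)$ and, if moreover $\|N\|\le\delta$, $$\lambda\|N\|\le F(M+N)-F(M)\le\Lambda\|N\|.$$ Let $u\in C(\overline B_1\times\mathbb R)$ be bounded, locally uniformly semiconcave in $Q_1$, and satisfy $F(D^2u)-u_t\le 0$ in $Q_1$ in the viscosity sense (that is, $F(D^2\varphi)-\varphi_t\le0$ at $(x,t)\in Q_1$ whenever $\varphi$ is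 smooth near $(x,t)$, $\varphi(x,t)=u(x,t)$ and $\varphi\le u$ near $(x,t)$ at times $\le t$). Let $\frac34\le\theta\le4$, $T_0>0$ and $PB^{-\theta}_{T_0}(x_0,t_0)\subset Q_1$. Then for every $a\in(0,c_0\delta)$ and every $PB^{\theta}_{T_1}(x_1,t_1)$ with $T_1>0$ and $(x_1,t_1)\in PB^{-\theta}_{T_0}(x_0,t_0)$, if $$\big(PB^{\theta}_{T_1}(x_1,t_1)\cap\{t=t_1+T_1\}\big)\cap\big(A_a(\overline Q_1)\cap PB^{-\theta}_{T_0}(x_0,t_0)\big)\ne\emptyset,$$ then $$\big|A_{c_1^{-1}a}(\overline Q_1)\cap PB^{-\theta}_{T_0}(x_0,t_0)\cap PB^{\theta}_{T_1}(x_1,t_1)\big|\ \ge\ c_1\,\big|PB^{\theta}_{T_1}(x_1,t_1)\big|.$$ -/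

import Mathlib

open Set Filter Topology MeasureTheory

noncomputable section

/-- Space `ℝⁿ` with the Euclidean norm; space-time points are pairs `(x, t)`. -/
abbrev Space (n : ℕ) : Type := EuclideanSpace ℝ (Fin n)

/-- The parabolic cylinder `Q₁ = B₁(0) × (-1, 0]`. -/
def Q1 (n : ℕ) : Set (Space n × ℝ) := Metric.ball 0 1 ×ˢ Set.Ioc (-1) 0

/-- Forward parabolic ball of opening `θ`: `θ |x - x₀|² ≤ t - t₀ ≤ T`. -/
def forwardPB {n : ℕ} (θ T : ℝ) (x₀ : Space n) (t₀ : ℝ) : Set (Space n × ℝ) :=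
  {p | θ * ‖p.1 - x₀‖ ^ 2 ≤ p.2 - t₀ ∧ p.2 - t₀ ≤ T}

/-- Backward parabolic ball of opening `θ`: `θ |x - x₀|² ≤ t₀ - t ≤ T`. -/
def backwardPB {n : ℕ} (θ T : ℝ) (x₀ : Space n) (t₀ : ℝ) : Set (Space n × ℝ) :=
  {p | θ * ‖p.1 - x₀‖ ^ 2 ≤ t₀ - p.2 ∧ t₀ - p.2 ≤ T}

/-- The concave parabola of opening `a` with vertex `v = (y, s)`. -/
def concaveParabola {n : ℕ} (v : Space n × ℝ) (a : ℝ) (p : Space n × ℝ) : ℝ :=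
  -(a / 2) * ‖p.1 - v.1‖ ^ 2 + a * (p.2 - v.2)

/-- The convex parabola of opening `a` with vertex `v = (y, s)`. -/
def convexParabola {n : ℕ} (v : Space n × ℝ) (a : ℝ) (p : Space n × ℝ) : ℝ :=
  a / 2 * ‖p.1 - v.1‖ ^ 2 - a * (p.2 - v.2)

/-- `φ` contacts `u` from below at `p = (x, t)`: `φ < u` on `B₁` at all times before `t`,
and `φ = u` at `p`. -/
def ContactsFromBelow {n : ℕ} (φ u : Space n × ℝ → ℝ) (p : Space n × ℝ) : Prop :=
  (∀ ξ ∈ Metric.ball (0 : Space n) 1, ∀ τ < p.2, φ (ξ, τ) < u (ξ, τ)) ∧ φ p = u p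

/-- `φ` contacts `u` from above at `p = (x, t)`. -/
def ContactsFromAbove {n : ℕ} (φ u : Space n × ℝ → ℝ) (p : Space n × ℝ) : Prop :=
  (∀ ξ ∈ Metric.ball (0 : Space n) 1, ∀ τ < p.2, u (ξ, τ) < φ (ξ, τ)) ∧ φ p = u p

/-- The contact set `A_a(E, u)`. The minimum of `u` over `Q₁` is written as an infimum, since `Q₁`
is not closed; for continuous `u` it is the minimum over the closure. -/
def contactSet {n : ℕ} (a : ℝ) (E : Set (Space n × ℝ)) (u : Space n × ℝ → ℝ) :
    Set (Space n × ℝ) :=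
  {p | p.1 ∈ Metric.closedBall (0 : Space n) 1 ∧
    ∃ v ∈ E, ContactsFromBelow (concaveParabola v a) (fun q => u q - sInf (u '' Q1 n)) p}

/-- `u` is locally uniformly semi-concave in `Q₁`: over each compact subset of `Q₁`, `u` is
contacted from above by convex parabolas of one common opening. -/
def LocallyUniformlySemiconcave {n : ℕ} (u : Space n × ℝ → ℝ) : Prop :=
  ∀ Z ⊆ Q1 n, IsCompact Z →
    ∃ b : ℝ, 0 < b ∧ ∀ p ∈ Z, ∃ v : Space n × ℝ, ContactsFromAbove (convexParabola v b) u p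

/-- The spectral norm of a matrix (its operator norm on Euclidean space). -/
def matSpectralNorm {n : ℕ} (M : Matrix (Fin n) (Fin n) ℝ) : ℝ :=
  ‖Matrix.toEuclideanCLM (n := Fin n) (𝕜 := ℝ) M‖

/-- The conditions on `F : Sym(n) → ℝ` at the zero solution: ellipticity, uniform ellipticity with
constants `lam ≤ Lam` near `0` (at scale `δ`), and `F(0) = 0`. The values of `F` at
matrices that are not symmetric never matter. -/
structure EllipticNearZero {n : ℕ} (lam Lam δ : ℝ) (F : Matrix (Fin n) (Fin n) ℝ → ℝ) :
    Prop where
  elliptic : ∀ M : Matrix (Fin n) (Fin n) ℝ, M.IsSymm → matSpectralNorm M < δ →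
    ∀ N : Matrix (Fin n) (Fin n) ℝ, N.PosSemidef → F M ≤ F (M + N)
  uniformlyElliptic : ∀ M : Matrix (Fin n) (Fin n) ℝ, M.IsSymm → matSpectralNorm M < δ →
    ∀ N : Matrix (Fin n) (Fin n) ℝ, N.PosSemidef → matSpectralNorm N ≤ δ →
      lam * matSpectralNorm N ≤ F (M + N) - F M ∧ F (M + N) - F M ≤ Lam * matSpectralNorm N
  zero_solution : F 0 = 0

/-- The Hessian `D²φ` in the space variables at `p = (x, t)`. -/
def spatialHessian {n : ℕ} (φ : Space n × ℝ → ℝ) (p : Space n × ℝ) :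
    Matrix (Fin n) (Fin n) ℝ :=
  Matrix.of fun i j => iteratedFDeriv ℝ 2 (fun x : Space n => φ (x, p.2)) p.1
    ![EuclideanSpace.single i 1, EuclideanSpace.single j 1]

/-- The time derivative `φ_t` at `p = (x, t)`. -/
def timeDeriv {n : ℕ} (φ : Space n × ℝ → ℝ) (p : Space n × ℝ) : ℝ :=
  deriv (fun τ : ℝ => φ (p.1, τ)) p.2

/-- `F(D²u) - u_t ≤ 0` in `Q₁` in the viscosity sense: a smooth test function that
touches `u` from below at a point `p` of `Q₁`, compared with `u` near `p` at times up to that of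
`p`, satisfies the inequality at `p`. -/
def IsViscositySupersolution {n : ℕ} (F : Matrix (Fin n) (Fin n) ℝ → ℝ)
    (u : Space n × ℝ → ℝ) : Prop :=
  ∀ p ∈ Q1 n, ∀ φ : Space n × ℝ → ℝ, ContDiffAt ℝ ((⊤ : ℕ∞) : WithTop ℕ∞) φ p →
    φ p = u p → (∀ᶠ q in 𝓝[{q : Space n × ℝ | q.2 ≤ p.2}] p, φ q ≤ u q) →
      F (spatialHessian φ p) - timeDeriv φ p ≤ 0

/-- The constant `c₀`, explicit in the dimension and the ellipticity constants. -/
def c0 (n : ℕ) (lam Lam : ℝ) : ℝ :=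
  lam ^ 2 / (Lam ^ 2 * (n + 5)) * Real.exp (-(10 ^ 6 * (Lam * n / lam) ^ 2))

end

/-! Let `P` be the parabola of opening `a`, raised by `inf u`, that touches `u` at the top point of
the forward ball. Positivity propagates back in time. If `u - P` were large on a small ball at an
earlier time, a bump under it, carried along a tube to the touching point and decaying
exponentially, would keep `u` above `P` there. Hence `u - P ≤ g * a * R ^ 2` at some point `(z, s)`
well inside both parabolic balls (`IsViscositySupersolution.exists_le_concaveParabola_add`).

Now add to `P` a second concave parabola of opening `b = 8 * g * a` with vertex `v` in a small
cylinder `V` just before `(z, s)`. The sum exceeds `u` only inside the positivity cone of the new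
summand, so it has a first contact point `c v` near `z` (`exists_contact_add`). Completing squares
turns the sum into one parabola of larger opening, so `c v` lies in the larger contact set
(`mem_contactSet_of_contact_add`).

It remains to bound `volume V` by the measure of the contact points. In place of an area formula,
the map from contact points back to vertices is controlled at every scale. Contact points within
parabolic distance `r` have vertices within a multiple of `r` in space and, after a shear, of `r ^
2` in time (`IsViscositySupersolution.vertex_sub_le`). This follows from the viscosity inequality
for quadratic test functions, one of them strongly convex along the difference of the two vertices.
Counting cells of a parabolic grid turns the estimate into a measure inequality
(`volume_le_mul_volume_of_sheared`).

All Hessians in use must stay within the range `δ` of uniform ellipticity; the smallness of `c0`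
ensures this. -/

/-! ### Comparison of smooth functions with supersolutions -/

theorem spatialHessian_add_const {n : ℕ} (φ : Space n × ℝ → ℝ) (c : ℝ) (p : Space n × ℝ) :
    spatialHessian (fun q => φ q + c) p = spatialHessian φ p := by
  unfold spatialHessian
  have h : fderiv ℝ (fun x => φ (x, p.2) + c) = fderiv ℝ (fun x => φ (x, p.2)) :=
    funext fun x => fderiv_add_const c
  ext i j
  simp only [Matrix.of_apply, iteratedFDeriv_two_apply, h]

theorem timeDeriv_add_const {n : ℕ} (φ : Space n × ℝ → ℝ) (c : ℝ) (p : Space n × ℝ) :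
    timeDeriv (fun q => φ q + c) p = timeDeriv φ p := by
  unfold timeDeriv
  simp only [deriv_add_const]

/-- If a smooth function exceeds a viscosity supersolution somewhere on a compact set, but not on
its parabolic boundary, then it satisfies the supersolution inequality where it exceeds it. -/
theorem IsViscositySupersolution.exists_le_of_lt {n : ℕ} {F : Matrix (Fin n) (Fin n) ℝ → ℝ}
    {u : Space n × ℝ → ℝ} (hu : IsViscositySupersolution F u)
    (hc : ContinuousOn u (Metric.closedBall (0 : Space n) 1 ×ˢ (Set.univ : Set ℝ)))
    {K : Set (Space n × ℝ)} (hK : IsCompact K) (hKQ : K ⊆ Q1 n) {Φ : Space n × ℝ → ℝ}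
    (hΦ : ContDiff ℝ ((⊤ : ℕ∞) : WithTop ℕ∞) Φ) {p₀ : Space n × ℝ} (hp₀ : p₀ ∈ K)
    (hlt : u p₀ < Φ p₀)
    (hb : ∀ p ∈ K, u p < Φ p → K ∈ 𝓝[{q : Space n × ℝ | q.2 ≤ p.2}] p) :
    ∃ p ∈ K, u p < Φ p ∧ F (spatialHessian Φ p) ≤ timeDeriv Φ p := by
  have hcK : ContinuousOn u K := hc.mono fun p hp =>
    ⟨Metric.ball_subset_closedBall (hKQ hp).1, trivial⟩
  obtain ⟨p, hp, hmin⟩ := hK.exists_isMinOn ⟨p₀, hp₀⟩ (hcK.sub hΦ.continuous.continuousOn)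
  have h1 : u p - Φ p ≤ u p₀ - Φ p₀ := hmin hp₀
  refine ⟨p, hp, by linarith, ?_⟩
  -- The minimum of `u - Φ` over `K` is negative, so `hb` makes `K` a neighbourhood of `p` in the
  -- past of `p`; shifted by the minimum, `Φ` is an admissible test function.
  have := hu p (hKQ hp) (fun q => Φ q + (u p - Φ p))
    ((hΦ.add contDiff_const).contDiffAt) (by ring) (by
      filter_upwards [hb p hp (by linarith)] with q hq
      have : u p - Φ p ≤ u q - Φ q := hmin hq
      linarith)
  rw [spatialHessian_add_const, timeDeriv_add_const] at this
  linarith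

theorem spatialHessian_eq_of_hasGradientAt {n : ℕ} {φ : Space n × ℝ → ℝ} {p : Space n × ℝ}
    {G : Space n → Space n} {A : Space n →L[ℝ] Space n}
    (hG : ∀ x, HasGradientAt (fun x => φ (x, p.2)) (G x) x) (hA : HasFDerivAt G A p.1) :
    spatialHessian φ p = Matrix.of fun i j =>
      inner ℝ (A (EuclideanSpace.single i 1)) (EuclideanSpace.single j 1) := by
  have h1 : fderiv ℝ (fun x => φ (x, p.2)) = fun x => innerSL ℝ (G x) := by
    funext x
    exact (hG x).hasFDerivAt.fderiv
  have h2 : HasFDerivAt (fun x => innerSL ℝ (G x)) ((innerSL ℝ).comp A) p.1 :=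
    (innerSL ℝ (E := Space n)).hasFDerivAt.comp p.1 hA
  unfold spatialHessian
  ext i j
  simp only [Matrix.of_apply, iteratedFDeriv_two_apply]
  rw [h1, h2.fderiv]
  simp

/-! ### Ellipticity near zero -/

theorem matSpectralNorm_smul_one_le {n : ℕ} {α : ℝ} (hα : 0 ≤ α) :
    matSpectralNorm (α • (1 : Matrix (Fin n) (Fin n) ℝ)) ≤ α := by
  unfold matSpectralNorm
  rw [map_smul, map_one, norm_smul, Real.norm_of_nonneg hα]
  exact mul_le_of_le_one_right hα ContinuousLinearMap.norm_id_le

theorem matSpectralNorm_neg {n : ℕ} (M : Matrix (Fin n) (Fin n) ℝ) :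
    matSpectralNorm (-M) = matSpectralNorm M := by
  unfold matSpectralNorm
  rw [map_neg, norm_neg]

theorem toEuclideanCLM_vecMulVec_apply {n : ℕ} (e x : Space n) :
    Matrix.toEuclideanCLM (n := Fin n) (𝕜 := ℝ) (Matrix.vecMulVec e e) x = inner ℝ e x • e := by
  ext i
  rw [Matrix.ofLp_toEuclideanCLM, Matrix.vecMulVec_mulVec]
  simp [PiLp.inner_apply, dotProduct, mul_comm]

theorem matSpectralNorm_vecMulVec {n : ℕ} (e : Space n) :
    matSpectralNorm (Matrix.vecMulVec e e : Matrix (Fin n) (Fin n) ℝ) = ‖e‖ ^ 2 := by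
  unfold matSpectralNorm
  refine le_antisymm (ContinuousLinearMap.opNorm_le_bound _ (by positivity) fun x => ?_) ?_
  · rw [toEuclideanCLM_vecMulVec_apply, norm_smul]
    calc ‖inner ℝ e x‖ * ‖e‖ ≤ (‖e‖ * ‖x‖) * ‖e‖ := by gcongr; exact norm_inner_le_norm e x
      _ = ‖e‖ ^ 2 * ‖x‖ := by ring
  · rcases eq_or_ne e 0 with rfl | he
    · simp
    · have h := (Matrix.toEuclideanCLM (n := Fin n) (𝕜 := ℝ) (Matrix.vecMulVec e e)).le_opNorm e
      rw [toEuclideanCLM_vecMulVec_apply, norm_smul, real_inner_self_eq_norm_sq, norm_pow,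
        norm_norm] at h
      exact le_of_mul_le_mul_right h (norm_pos_iff.2 he)

/-- Lower bound for an operator that is elliptic near zero, at a rank-one perturbation of a
negative multiple of the identity. -/
theorem EllipticNearZero.le_apply {n : ℕ} {lam Lam δ : ℝ} {F : Matrix (Fin n) (Fin n) ℝ → ℝ}
    (hF : EllipticNearZero lam Lam δ F) (hLam : 0 ≤ Lam) {α β : ℝ} {e : Space n}
    (hα : 0 ≤ α) (hαδ : α < δ) (hβ : 0 ≤ β) (hβδ : β * ‖e‖ ^ 2 ≤ δ) :
    lam * (β * ‖e‖ ^ 2) - Lam * α ≤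
      F (-(α • (1 : Matrix (Fin n) (Fin n) ℝ)) + β • Matrix.vecMulVec e e) := by
  have hs : (-(α • (1 : Matrix (Fin n) (Fin n) ℝ))).IsSymm := by
    simp [Matrix.IsSymm, Matrix.transpose_smul]
  have hα' := matSpectralNorm_smul_one_le (n := n) hα
  have hn : matSpectralNorm (-(α • (1 : Matrix (Fin n) (Fin n) ℝ))) < δ := by
    rw [matSpectralNorm_neg]; exact hα'.trans_lt hαδ
  have hp1 : (α • (1 : Matrix (Fin n) (Fin n) ℝ)).PosSemidef := Matrix.PosSemidef.one.smul hα
  have hp2 : (β • (Matrix.vecMulVec e e : Matrix (Fin n) (Fin n) ℝ)).PosSemidef := by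
    refine Matrix.PosSemidef.smul ?_ hβ
    simpa using Matrix.posSemidef_vecMulVec_self_star (R := ℝ) (e : Fin n → ℝ)
  have hn2 : matSpectralNorm (β • (Matrix.vecMulVec e e : Matrix (Fin n) (Fin n) ℝ)) =
      β * ‖e‖ ^ 2 := by
    rw [← matSpectralNorm_vecMulVec]
    unfold matSpectralNorm
    rw [map_smul, norm_smul, Real.norm_of_nonneg hβ]
  -- Both increments start at `-α I`: adding `α I` leads to `F 0 = 0` and costs at most `Lam * α`,
  -- while the rank-one part gains at least `lam` times its norm.
  have h1 := (hF.uniformlyElliptic _ hs hn _ hp1 (hα'.trans hαδ.le)).2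
  have h2 := (hF.uniformlyElliptic _ hs hn _ hp2 (hn2.trans_le hβδ)).1
  rw [neg_add_cancel, hF.zero_solution] at h1
  rw [hn2] at h2
  nlinarith

theorem spatialHessian_eq_neg_smul_one_add {n : ℕ} {φ : Space n × ℝ → ℝ} {p : Space n × ℝ}
    {G : Space n → Space n} {α β : ℝ} {e : Space n}
    (hG : ∀ x, HasGradientAt (fun x => φ (x, p.2)) (G x) x)
    (hA : HasFDerivAt G (-(α • ContinuousLinearMap.id ℝ (Space n)) +
      β • (innerSL ℝ e).smulRight e) p.1) :
    spatialHessian φ p =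
      -(α • (1 : Matrix (Fin n) (Fin n) ℝ)) + β • Matrix.vecMulVec e e := by
  rw [spatialHessian_eq_of_hasGradientAt hG hA]
  ext i j
  have h1 : inner ℝ (EuclideanSpace.single i (1 : ℝ)) (EuclideanSpace.single j (1 : ℝ)) =
      (1 : Matrix (Fin n) (Fin n) ℝ) i j := by
    simp [Matrix.one_apply, EuclideanSpace.inner_single_left]
  simp only [Matrix.of_apply, add_apply, neg_apply,
    smul_apply, ContinuousLinearMap.id_apply, inner_add_left, inner_neg_left,
    inner_smul_left, h1]
  simp [Matrix.vecMulVec_apply, EuclideanSpace.inner_single_right, inner_smul_left]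

/-! ### Test functions and their derivatives -/

theorem hasGradientAt_norm_sub_sq {n : ℕ} (c x : Space n) :
    HasGradientAt (fun x : Space n => ‖x - c‖ ^ 2) ((2 : ℝ) • (x - c)) x := by
  rw [hasGradientAt_iff_hasFDerivAt]
  refine HasFDerivAt.congr_fderiv ((hasFDerivAt_id (𝕜 := ℝ) x).sub_const c).norm_sq ?_
  ext y
  simp

theorem contDiff_concaveParabola {n : ℕ} (v : Space n × ℝ) (a : ℝ) {k : WithTop ℕ∞} :
    ContDiff ℝ k (concaveParabola v a) := by
  unfold concaveParabola
  have : ContDiff ℝ k fun p : Space n × ℝ => ‖p.1 - v.1‖ ^ 2 :=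
    (contDiff_fst.sub contDiff_const).norm_sq ℝ
  fun_prop

theorem hasGradientAt_concaveParabola {n : ℕ} (v : Space n × ℝ) (a t : ℝ) (x : Space n) :
    HasGradientAt (fun x => concaveParabola v a (x, t)) (-(a • (x - v.1))) x := by
  have h := ((hasGradientAt_norm_sub_sq v.1 x).hasFDerivAt.const_mul (-(a / 2))).add_const
    (a * (t - v.2))
  rw [hasGradientAt_iff_hasFDerivAt]
  unfold concaveParabola
  refine h.congr_fderiv ?_
  ext y
  simp
  ring

theorem hasDerivAt_concaveParabola {n : ℕ} (v : Space n × ℝ) (a t : ℝ) (x : Space n) :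
    HasDerivAt (fun τ => concaveParabola v a (x, τ)) a t := by
  unfold concaveParabola
  have h := (((hasDerivAt_id t).sub_const v.2).const_mul a).const_add (-(a / 2) * ‖x - v.1‖ ^ 2)
  simpa using h

/-- Quadratic test function: two concave parabolas and a polynomial in a single direction `e`. -/
noncomputable def quadraticTest {n : ℕ} (m a b : ℝ) (v w : Space n × ℝ) (K₁ K₂ K₃ ρ : ℝ)
    (e : Space n) (p : Space n × ℝ) (q : Space n × ℝ) : ℝ :=
  m + concaveParabola v a q + concaveParabola w b q + (-K₁ * ‖q.1 - p.1‖ ^ 2 +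
    K₂ * (inner ℝ e (q.1 - p.1) + ρ) ^ 2 + K₃ * (q.2 - p.2))

theorem contDiff_quadraticTest {n : ℕ} (m a b : ℝ) (v w : Space n × ℝ) (K₁ K₂ K₃ ρ : ℝ)
    (e : Space n) (p : Space n × ℝ) {k : WithTop ℕ∞} :
    ContDiff ℝ k (quadraticTest m a b v w K₁ K₂ K₃ ρ e p) := by
  unfold quadraticTest
  have h1 : ContDiff ℝ k fun q : Space n × ℝ => ‖q.1 - p.1‖ ^ 2 :=
    (contDiff_fst.sub contDiff_const).norm_sq ℝ
  have h2 : ContDiff ℝ k fun q : Space n × ℝ => inner ℝ e (q.1 - p.1) :=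
    contDiff_const.inner ℝ (contDiff_fst.sub contDiff_const)
  have h3 := contDiff_concaveParabola (k := k) v a
  have h4 := contDiff_concaveParabola (k := k) w b
  fun_prop

theorem spatialHessian_quadraticTest {n : ℕ} (m a b : ℝ) (v w : Space n × ℝ) (K₁ K₂ K₃ ρ : ℝ)
    (e : Space n) (p q : Space n × ℝ) :
    spatialHessian (quadraticTest m a b v w K₁ K₂ K₃ ρ e p) q =
      -((a + b + 2 * K₁) • (1 : Matrix (Fin n) (Fin n) ℝ)) +
        (2 * K₂) • Matrix.vecMulVec e e := by
  refine spatialHessian_eq_neg_smul_one_add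
    (G := fun x => -(a • (x - v.1)) - b • (x - w.1) - (2 * K₁) • (x - p.1) +
      (2 * K₂ * (inner ℝ e (x - p.1) + ρ)) • e) (fun x => ?_) ?_
  · have hi : HasFDerivAt (fun x : Space n => inner ℝ e (x - p.1) + ρ) (innerSL ℝ e) x :=
      ((innerSL ℝ e).hasFDerivAt.comp x ((hasFDerivAt_id x).sub_const p.1)).add_const ρ
    have h := (((hasGradientAt_concaveParabola v a q.2 x).hasFDerivAt.const_add m).add
      (hasGradientAt_concaveParabola w b q.2 x).hasFDerivAt).add
      ((((hasGradientAt_norm_sub_sq p.1 x).hasFDerivAt.const_mul (-K₁)).add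
      ((hi.pow 2).const_mul K₂)).add_const (K₃ * (q.2 - p.2)))
    rw [hasGradientAt_iff_hasFDerivAt]
    unfold quadraticTest
    refine h.congr_fderiv ?_
    ext y
    simp
    ring
  · have hi : HasFDerivAt (fun x : Space n => 2 * K₂ * (inner ℝ e (x - p.1) + ρ))
        ((2 * K₂) • innerSL ℝ e) q.1 :=
      (((innerSL ℝ e).hasFDerivAt.comp q.1 ((hasFDerivAt_id q.1).sub_const p.1)).add_const
        ρ).const_mul _
    have hs : ∀ c : Space n, HasFDerivAt (fun x : Space n => x - c)
      (ContinuousLinearMap.id ℝ (Space n)) q.1 := fun c => (hasFDerivAt_id q.1).sub_const c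
    have h := ((((hs v.1).const_smul a).neg.sub ((hs w.1).const_smul b)).sub
      ((hs p.1).const_smul (2 * K₁))).add (hi.smul_const e)
    refine h.congr_fderiv ?_
    ext y i
    simp
    ring

theorem timeDeriv_quadraticTest {n : ℕ} (m a b : ℝ) (v w : Space n × ℝ) (K₁ K₂ K₃ ρ : ℝ)
    (e : Space n) (p q : Space n × ℝ) :
    timeDeriv (quadraticTest m a b v w K₁ K₂ K₃ ρ e p) q = a + b + K₃ := by
  have h := (((hasDerivAt_concaveParabola v a q.2 q.1).const_add m).add
    (hasDerivAt_concaveParabola w b q.2 q.1)).add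
    ((((hasDerivAt_id q.2).sub_const p.2).const_mul K₃).const_add
      (-K₁ * ‖q.1 - p.1‖ ^ 2 + K₂ * (inner ℝ e (q.1 - p.1) + ρ) ^ 2))
  refine Eq.trans h.deriv ?_
  simp

/-- A bump supported in a ball of radius `R` that moves with velocity `d` and decays in time. -/
noncomputable def movingBumpTest {n : ℕ} (m a : ℝ) (v : Space n × ℝ) (H k R s : ℝ)
    (c d : Space n) (q : Space n × ℝ) : ℝ :=
  m + concaveParabola v a q + H * Real.exp (-(k * (q.2 - s))) *
    (1 - ‖q.1 - (c + (q.2 - s) • d)‖ ^ 2 / R ^ 2) ^ 2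

theorem contDiff_movingBumpTest {n : ℕ} (m a : ℝ) (v : Space n × ℝ) (H k R s : ℝ)
    (c d : Space n) {j : WithTop ℕ∞} : ContDiff ℝ j (movingBumpTest m a v H k R s c d) := by
  unfold movingBumpTest
  have h1 : ContDiff ℝ j fun q : Space n × ℝ => ‖q.1 - (c + (q.2 - s) • d)‖ ^ 2 :=
    ContDiff.norm_sq ℝ (by fun_prop)
  have h3 := contDiff_concaveParabola (k := j) v a
  have h4 : ContDiff ℝ j fun q : Space n × ℝ => Real.exp (-(k * (q.2 - s))) :=
    ContDiff.exp (by fun_prop)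
  exact (contDiff_const.add h3).add ((contDiff_const.mul h4).mul
    ((contDiff_const.sub (h1.div_const _)).pow 2))

theorem spatialHessian_movingBumpTest {n : ℕ} (m a : ℝ) (v : Space n × ℝ) (H k R s : ℝ)
    (c d : Space n) (q : Space n × ℝ) :
    spatialHessian (movingBumpTest m a v H k R s c d) q =
      -((a + 4 * (H * Real.exp (-(k * (q.2 - s)))) / R ^ 2 *
        (1 - ‖q.1 - (c + (q.2 - s) • d)‖ ^ 2 / R ^ 2)) • (1 : Matrix (Fin n) (Fin n) ℝ)) +
        (8 * (H * Real.exp (-(k * (q.2 - s)))) / R ^ 4) •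
          Matrix.vecMulVec (q.1 - (c + (q.2 - s) • d)) (q.1 - (c + (q.2 - s) • d)) := by
  set h := H * Real.exp (-(k * (q.2 - s))) with hh
  set c' := c + (q.2 - s) • d with hc'
  have hn : ∀ x, HasFDerivAt (fun x : Space n => 1 - ‖x - c'‖ ^ 2 / R ^ 2)
      (-((2 / R ^ 2) • innerSL ℝ (x - c'))) x := fun x => by
    have := ((hasGradientAt_norm_sub_sq c' x).hasFDerivAt.mul_const (R ^ 2)⁻¹).const_sub 1
    refine this.congr_fderiv ?_
    ext y
    simp
    ring
  refine spatialHessian_eq_neg_smul_one_add (G := fun x => -(a • (x - v.1)) -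
    (4 * h / R ^ 2 * (1 - ‖x - c'‖ ^ 2 / R ^ 2)) • (x - c')) (fun x => ?_) ?_
  · have := ((hasGradientAt_concaveParabola v a q.2 x).hasFDerivAt.const_add m).add
      (((hn x).pow 2).const_mul h)
    rw [hasGradientAt_iff_hasFDerivAt]
    unfold movingBumpTest
    refine this.congr_fderiv ?_
    ext y
    simp
    ring
  · have hs : ∀ c : Space n, HasFDerivAt (fun x : Space n => x - c)
      (ContinuousLinearMap.id ℝ (Space n)) q.1 := fun c => (hasFDerivAt_id q.1).sub_const c
    have := ((hs v.1).const_smul a).neg.sub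
      (((hn q.1).const_mul (4 * h / R ^ 2)).smul (hs c'))
    refine this.congr_fderiv ?_
    ext y i
    simp
    ring

theorem timeDeriv_movingBumpTest {n : ℕ} (m a : ℝ) (v : Space n × ℝ) (H k R s : ℝ)
    (c d : Space n) (q : Space n × ℝ) :
    timeDeriv (movingBumpTest m a v H k R s c d) q = a + H * Real.exp (-(k * (q.2 - s))) *
      (-k * (1 - ‖q.1 - (c + (q.2 - s) • d)‖ ^ 2 / R ^ 2) ^ 2 +
        4 * (1 - ‖q.1 - (c + (q.2 - s) • d)‖ ^ 2 / R ^ 2) *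
          (inner ℝ (q.1 - (c + (q.2 - s) • d)) d / R ^ 2)) := by
  have h1 : HasDerivAt (fun τ : ℝ => q.1 - (c + (τ - s) • d)) (-d) q.2 := by
    simpa using ((((hasDerivAt_id q.2).sub_const s).smul_const d).const_add c).const_sub q.1
  have h2 := h1.norm_sq
  have h3 : HasDerivAt (fun τ : ℝ => Real.exp (-(k * (τ - s))))
      (Real.exp (-(k * (q.2 - s))) * (-k)) q.2 := by
    simpa using ((((hasDerivAt_id q.2).sub_const s).const_mul k).neg).exp
  have h := ((hasDerivAt_concaveParabola v a q.2 q.1).const_add m).add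
    ((h3.const_mul H).mul (((h2.div_const (R ^ 2)).const_sub 1).pow 2))
  have := h.deriv
  unfold timeDeriv movingBumpTest
  refine Eq.trans this ?_
  simp [inner_neg_right]
  ring

/-- For equal openings the quadratic and time terms cancel: the difference is affine in space with
slope `b` times the vertex difference, and constant in time. All comparisons of two touching
parabolas rest on this. -/
theorem concaveParabola_sub_eq {n : ℕ} (v v' : Space n × ℝ) (b : ℝ) (p q : Space n × ℝ) :
    concaveParabola v' b q - concaveParabola v b q =
      concaveParabola v' b p - concaveParabola v b p + b * inner ℝ (v'.1 - v.1) (q.1 - p.1) := by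
  unfold concaveParabola
  have h : ∀ w : Space n, ‖q.1 - w‖ ^ 2 = ‖p.1 - w‖ ^ 2 + 2 * inner ℝ (p.1 - w) (q.1 - p.1) +
      ‖q.1 - p.1‖ ^ 2 := fun w => by
    rw [← norm_add_sq_real]; congr 2; abel
  rw [h v.1, h v'.1]
  simp only [inner_sub_left]
  ring

/-! ### Propagation of positivity -/

/-- This makes the moving bump a strict subsolution; `S` is one minus the squared relative distance
to the moving center. The decay rate `16 * Lam ^ 2 / lam` completes the square `4 * lam * (1 - 2 *
Lam * S / lam) ^ 2`, and the remaining `4 * lam * h` absorbs the terms in `a`. -/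
theorem bump_inequality {lam Lam a h S D : ℝ} (hlam : 0 < lam) (hlam1 : lam ≤ 1)
    (hLam : 1 ≤ Lam) (ha : 0 < a) (hah : (1 + Lam) * a ≤ lam * h) (hh : 0 < h) (hS : 0 ≤ S)
    (hD : D ≤ 1) :
    a + h * (-(16 * Lam ^ 2 / lam) * S ^ 2 + 4 * S * D) <
      lam * (8 * h * (1 - S)) - Lam * (a + 4 * h * S) := by
  have e4 : h * (4 * S * D) ≤ h * (4 * S * 1) := by gcongr
  have e6 : 4 * lam * (1 - 2 * Lam * S / lam) ^ 2 =
    4 * lam - 16 * Lam * S + 16 * Lam ^ 2 / lam * S ^ 2 := by field_simp; ring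
  have e0 : 0 ≤ 4 * lam * (1 - 2 * Lam * S / lam) ^ 2 := by positivity
  have e1 : lam * S ≤ Lam * S := by gcongr; linarith
  have e2 : S ≤ Lam * S := by nlinarith
  have e5 : 4 * lam ≤ lam * (8 * (1 - S)) - Lam * (4 * S) + 16 * Lam ^ 2 / lam * S ^ 2 - 4 * S := by
    linarith
  have e7 := mul_le_mul_of_nonneg_left e5 hh.le
  have e8 : 0 < (1 + Lam) * a := by positivity
  linarith

set_option maxHeartbeats 1000000 in
/-- Propagation of positivity: a supersolution that lies above a concave parabola and touches it
inside the final ball of a moving tube is close to the parabola in the initial ball. -/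
theorem IsViscositySupersolution.exists_le_concaveParabola_add {n : ℕ} {lam Lam δ : ℝ}
    {F : Matrix (Fin n) (Fin n) ℝ → ℝ} {u : Space n × ℝ → ℝ}
    (hlam : 0 < lam) (hlam1 : lam ≤ 1) (hLam : 1 ≤ Lam) (hF : EllipticNearZero lam Lam δ F)
    (hu : IsViscositySupersolution F u)
    (hc : ContinuousOn u (Metric.closedBall (0 : Space n) 1 ×ˢ (Set.univ : Set ℝ)))
    {m a : ℝ} {v : Space n × ℝ} (ha : 0 < a) {R s t E : ℝ} {c d x : Space n} (hR : 0 < R)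
    (hst : s ≤ t) (hs : -1 < s) (ht : t ≤ 0)
    (hball : ∀ τ ∈ Icc s t, Metric.closedBall (c + (τ - s) • d) R ⊆ Metric.ball 0 1)
    (hge : ∀ ξ ∈ Metric.ball (0 : Space n) 1, ∀ τ ∈ Icc s t,
      m + concaveParabola v a (ξ, τ) ≤ u (ξ, τ))
    (hx : ‖x - (c + (t - s) • d)‖ < R) (hux : u (x, t) = m + concaveParabola v a (x, t))
    (hd : R * ‖d‖ ≤ 1) (hE : 16 * Lam ^ 2 / lam / R ^ 2 * (t - s) ≤ E)
    (hδ : 8 * (Real.exp E * (1 + Lam) / lam * a) ≤ δ) :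
    ∃ z ∈ Metric.closedBall c R,
      u (z, s) ≤ m + concaveParabola v a (z, s) + Real.exp E * (1 + Lam) / lam * a * R ^ 2 := by
  by_contra! hcon
  -- The factor `exp E` compensates the decay of the bump along the whole tube, so its height
  -- divided by `R ^ 2` never falls below `(1 + Lam) / lam * a`.
  set g := Real.exp E * (1 + Lam) / lam * a with hg
  set k := 16 * Lam ^ 2 / lam / R ^ 2 with hk
  have hk0 : 0 ≤ k := by positivity
  have hgpos : 0 < g := by positivity
  -- By contradiction, `Φ < u` at time `s`; on the lateral boundary the bump vanishes and `Φ ≤ u`;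
  -- at `(x, t)` the bump is positive and `Φ > u`. So the supersolution inequality must hold
  -- somewhere for the strict subsolution `Φ`.
  set Φ := movingBumpTest m a v (g * R ^ 2) k R s c d with hΦ
  set K : Set (Space n × ℝ) := (fun q : Space n × ℝ => (q.1 + (c + (q.2 - s) • d), q.2)) ''
    (Metric.closedBall 0 R ×ˢ Icc s t) with hK
  have hmem : ∀ q : Space n × ℝ, q ∈ K ↔ ‖q.1 - (c + (q.2 - s) • d)‖ ≤ R ∧ q.2 ∈ Icc s t := by
    intro q
    constructor
    · rintro ⟨q', ⟨h1, h2⟩, rfl⟩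
      refine ⟨?_, h2⟩
      simpa using h1
    · rintro ⟨h1, h2⟩
      exact ⟨(q.1 - (c + (q.2 - s) • d), q.2), ⟨by simpa using h1, h2⟩, by simp⟩
  have hKc : IsCompact K := ((isCompact_closedBall _ _).prod isCompact_Icc).image (by fun_prop)
  have hKb : ∀ q ∈ K, q.1 ∈ Metric.ball (0 : Space n) 1 ∧ q.2 ∈ Icc s t := fun q hq =>
    ⟨hball _ ((hmem q).1 hq).2 (by simpa [dist_eq_norm] using ((hmem q).1 hq).1),
      ((hmem q).1 hq).2⟩
  have hKQ : K ⊆ Q1 n := fun q hq =>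
    ⟨(hKb q hq).1, hs.trans_le (hKb q hq).2.1, (hKb q hq).2.2.trans ht⟩
  have hR2 : 0 < R ^ 2 := by positivity
  have hS : ∀ q ∈ K, 0 ≤ 1 - ‖q.1 - (c + (q.2 - s) • d)‖ ^ 2 / R ^ 2 ∧
      1 - ‖q.1 - (c + (q.2 - s) • d)‖ ^ 2 / R ^ 2 ≤ 1 := fun q hq => by
    have h1 : ‖q.1 - (c + (q.2 - s) • d)‖ ^ 2 / R ^ 2 ≤ 1 :=
      (div_le_one hR2).2 (pow_le_pow_left₀ (norm_nonneg _) ((hmem q).1 hq).1 2)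
    have h2 : 0 ≤ ‖q.1 - (c + (q.2 - s) • d)‖ ^ 2 / R ^ 2 := by positivity
    constructor <;> linarith
  have hfin : ((x, t) : Space n × ℝ) ∈ K := (hmem _).2 ⟨hx.le, right_mem_Icc.2 hst⟩
  obtain ⟨p, hpK, hlt, hFp⟩ := hu.exists_le_of_lt hc hKc hKQ (Φ := Φ)
    (contDiff_movingBumpTest _ _ _ _ _ _ _ _ _) hfin (by
      rw [hux]
      refine lt_add_of_pos_right _ ?_
      have : 0 < 1 - ‖x - (c + (t - s) • d)‖ ^ 2 / R ^ 2 := by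
        have := (div_lt_one hR2).2 (pow_lt_pow_left₀ hx (norm_nonneg _) two_ne_zero)
        linarith
      positivity) (by
    intro p hp hlt
    have hp1 := (hmem p).1 hp
    have hup := hge p.1 (hKb p hp).1 p.2 hp1.2
    have h1 : s < p.2 := by
      refine lt_of_le_of_ne hp1.2.1 fun hsp => ?_
      have h2 := hcon p.1 (by simpa [dist_eq_norm, ← hsp] using hp1.1)
      rw [hsp] at h2
      refine lt_asymm hlt (lt_of_le_of_lt ?_ h2)
      rw [hΦ, movingBumpTest]
      have h3 := hS p hp
      have : (1 - ‖p.1 - (c + (p.2 - s) • d)‖ ^ 2 / R ^ 2) ^ 2 ≤ 1 :=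
        pow_le_one₀ h3.1 h3.2
      have h4 : Real.exp (-(k * (p.2 - s))) = 1 := by rw [← hsp]; simp
      rw [h4, mul_one]
      have := mul_le_mul_of_nonneg_left this (by positivity : 0 ≤ g * R ^ 2)
      linarith
    have h2 : ‖p.1 - (c + (p.2 - s) • d)‖ < R := by
      refine lt_of_le_of_ne hp1.1 fun hRp => ?_
      refine absurd hup (not_le.2 ?_)
      rw [hΦ, movingBumpTest, hRp, div_self hR2.ne'] at hlt
      simpa using hlt
    have hop : IsOpen {q : Space n × ℝ | s < q.2 ∧ ‖q.1 - (c + (q.2 - s) • d)‖ < R} := by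
      have hcn : Continuous fun q : Space n × ℝ => ‖q.1 - (c + (q.2 - s) • d)‖ := by fun_prop
      exact (isOpen_lt continuous_const continuous_snd).inter (isOpen_lt hcn continuous_const)
    filter_upwards [mem_nhdsWithin_of_mem_nhds (hop.mem_nhds ⟨h1, h2⟩), self_mem_nhdsWithin]
      with q hq hq2
    exact (hmem q).2 ⟨hq.2.le, hq.1.le, hq2.trans hp1.2.2⟩)
  rw [hΦ, spatialHessian_movingBumpTest, timeDeriv_movingBumpTest] at hFp
  have hS1 := hS p hpK
  have hp1 := (hmem p).1 hpK
  set ζ := p.1 - (c + (p.2 - s) • d) with hζ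
  set S := 1 - ‖ζ‖ ^ 2 / R ^ 2 with hSdef
  set w := Real.exp (-(k * (p.2 - s))) with hw
  have hzS : ‖ζ‖ ^ 2 = R ^ 2 * (1 - S) := by rw [hSdef]; field_simp; ring
  have hw1 : w ≤ 1 := Real.exp_le_one_iff.2 (by
    have := mul_nonneg hk0 (sub_nonneg.2 hp1.2.1); linarith)
  have hw0 : 0 < w := Real.exp_pos _
  have hwE : 1 ≤ w * Real.exp E := by
    rw [hw, ← Real.exp_add]
    refine Real.one_le_exp ?_
    have := mul_le_mul_of_nonneg_left (sub_le_sub_right hp1.2.2 s) hk0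
    linarith
  have hE1 : (1 + Lam) / lam * a ≤ w * g := by
    calc (1 + Lam) / lam * a = 1 * ((1 + Lam) / lam * a) := by ring
      _ ≤ w * Real.exp E * ((1 + Lam) / lam * a) := by gcongr
      _ = w * g := by rw [hg]; ring
  set h := w * g with hh
  have hlh : (1 + Lam) * a ≤ lam * h := by
    have := mul_le_mul_of_nonneg_left hE1 hlam.le
    calc (1 + Lam) * a = lam * ((1 + Lam) / lam * a) := by field_simp
      _ ≤ _ := this
  have hhpos : 0 < h := by positivity
  have hhg : h ≤ g := by rw [hh]; nlinarith
  have hah : 2 * a ≤ h := by nlinarith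
  have e1 : 4 * (g * R ^ 2 * w) / R ^ 2 * S = 4 * h * S := by rw [hh]; field_simp
  have e2 : 8 * (g * R ^ 2 * w) / R ^ 4 * ‖ζ‖ ^ 2 = 8 * h * (1 - S) := by
    rw [hzS, hh]; field_simp
  have hlow := hF.le_apply (by linarith) (α := a + 4 * (g * R ^ 2 * w) / R ^ 2 * S)
    (β := 8 * (g * R ^ 2 * w) / R ^ 4) (e := ζ)
    (by rw [e1]; have := hS1.1; positivity) (by rw [e1]; nlinarith) (by positivity)
    (by rw [e2]; nlinarith)
  rw [e1, e2] at hlow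
  have hdr : inner ℝ ζ d ≤ 1 := by
    calc inner ℝ ζ d ≤ ‖ζ‖ * ‖d‖ := real_inner_le_norm _ _
      _ ≤ R * ‖d‖ := by gcongr; exact hp1.1
      _ ≤ 1 := hd
  have e3 : g * R ^ 2 * w * (-k * S ^ 2 + 4 * S * (inner ℝ ζ d / R ^ 2)) =
      h * (-(16 * Lam ^ 2 / lam) * S ^ 2 + 4 * S * inner ℝ ζ d) := by
    rw [hk, hh]; field_simp
  rw [e3] at hFp
  rw [e1] at hFp
  exact absurd (hlow.trans hFp)
    (not_le.2 (bump_inequality hlam hlam1 hLam ha hlh hhpos hS1.1 hdr))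

/-! ### Comparison of two parabolas below a supersolution -/

/-- Comparison forward in time: if a parabola touches a supersolution from below at `p'`, then
shortly after it is not much larger than another parabola touching at a later point `p`. -/
theorem IsViscositySupersolution.concaveParabola_sub_le {n : ℕ} {lam Lam δ : ℝ}
    {F : Matrix (Fin n) (Fin n) ℝ → ℝ} {u : Space n × ℝ → ℝ}
    (hLam : 1 ≤ Lam) (hF : EllipticNearZero lam Lam δ F)
    (hu : IsViscositySupersolution F u)
    (hc : ContinuousOn u (Metric.closedBall (0 : Space n) 1 ×ˢ (Set.univ : Set ℝ)))
    {m a b : ℝ} {v₀ v v' p p' : Space n × ℝ} (ha : 0 < a) (hb : 0 < b)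
    (hδ : a + b + 2 * b < δ) {ρ : ℝ} (hρ : ‖p.1 - p'.1‖ ≤ ρ) (htt : p'.2 ≤ p.2)
    (hball : Metric.closedBall p'.1 ρ ⊆ Metric.ball 0 1) (ht' : -1 < p'.2) (ht : p.2 ≤ 0)
    (hge : ∀ ξ ∈ Metric.ball (0 : Space n) 1, ∀ τ ∈ Icc p'.2 p.2,
      m + concaveParabola v₀ a (ξ, τ) + concaveParabola v b (ξ, τ) ≤ u (ξ, τ))
    (hge' : ∀ ξ ∈ Metric.ball (0 : Space n) 1,
      m + concaveParabola v₀ a (ξ, p'.2) + concaveParabola v' b (ξ, p'.2) ≤ u (ξ, p'.2))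
    (heq : u p = m + concaveParabola v₀ a p + concaveParabola v b p)
    (hσ : 2 * ‖v'.1 - v.1‖ ≤ ρ)
    (hX : 2 * (concaveParabola v' b p' - concaveParabola v b p') ≤ b * ρ ^ 2) :
    concaveParabola v' b p - concaveParabola v b p ≤
      b * ‖p.1 - p'.1‖ ^ 2 + (2 * Lam * b + (Lam + 2) * (a + b)) * (p.2 - p'.2) := by
  by_contra! hcon
  -- The Hessian of `Φ` is `-(a + 3 * b) I`. With this `B`, the time derivative `a + b - B` lies
  -- below the ellipticity bound `-Lam * (a + 3 * b)` by `a + b`.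
  set B := 2 * Lam * b + (Lam + 2) * (a + b) with hB
  have hBpos : 0 < B := by positivity
  set Φ := quadraticTest m a b v₀ v' b 0 (-B) 0 (0 : Space n) p' with hΦ
  have hΦe : ∀ q, Φ q = m + concaveParabola v₀ a q + concaveParabola v' b q -
      b * ‖q.1 - p'.1‖ ^ 2 - B * (q.2 - p'.2) := fun q => by
    rw [hΦ, quadraticTest]; ring
  have hKQ : Metric.closedBall p'.1 ρ ×ˢ Icc p'.2 p.2 ⊆ Q1 n := fun q hq =>
    ⟨hball hq.1, ht'.trans_le hq.2.1, hq.2.2.trans ht⟩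
  obtain ⟨q, hqK, hlt, hFq⟩ := hu.exists_le_of_lt hc
    (K := Metric.closedBall p'.1 ρ ×ˢ Icc p'.2 p.2)
    ((isCompact_closedBall _ _).prod isCompact_Icc) hKQ (Φ := Φ)
    (contDiff_quadraticTest _ _ _ _ _ _ _ _ _ _ _) (p₀ := p)
    ⟨by simpa [dist_eq_norm] using hρ, right_mem_Icc.2 htt⟩ (by rw [hΦe, heq]; linarith) (by
    intro q hq hlt
    have hqb := hball hq.1
    have hq1 : ‖q.1 - p'.1‖ ≤ ρ := by simpa [dist_eq_norm] using hq.1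
    rw [hΦe] at hlt
    have h1 : p'.2 < q.2 := by
      refine lt_of_le_of_ne hq.2.1 fun h => ?_
      have h2 := hge' q.1 hqb
      rw [h] at h2
      have : 0 ≤ b * ‖q.1 - p'.1‖ ^ 2 := by positivity
      rw [← h, sub_self] at hlt
      change _ ≤ u q at h2
      linarith
    -- On the lateral boundary the `v'` parabola exceeds the `v` parabola by at most `b * ρ ^ 2`,
    -- half from `hX` and half from `hσ`; the penalty removes this, so `Φ` is below the `v` parabola
    -- and hence below `u`.
    have h2 : ‖q.1 - p'.1‖ < ρ := by
      refine lt_of_le_of_ne hq1 fun h => ?_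
      have h2 := hge q.1 hqb q.2 hq.2
      have h3 := concaveParabola_sub_eq v v' b p' q
      have h4 : inner ℝ (v'.1 - v.1) (q.1 - p'.1) ≤ ‖v'.1 - v.1‖ * ρ :=
        (real_inner_le_norm _ _).trans_eq (by rw [h])
      have h5 : 0 ≤ B * (q.2 - p'.2) := mul_nonneg hBpos.le (sub_nonneg.2 hq.2.1)
      have h6 : b * inner ℝ (v'.1 - v.1) (q.1 - p'.1) ≤ b * (‖v'.1 - v.1‖ * ρ) := by gcongr
      have h7 : b * (2 * ‖v'.1 - v.1‖ * ρ) ≤ b * (ρ * ρ) := by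
        have : 0 ≤ ρ := h ▸ norm_nonneg _
        gcongr
      rw [h] at hlt
      change _ ≤ u q at h2
      simp only [Prod.mk.eta] at h2
      nlinarith
    have hop : IsOpen (Metric.ball p'.1 ρ ×ˢ Ioi p'.2) := Metric.isOpen_ball.prod isOpen_Ioi
    filter_upwards [mem_nhdsWithin_of_mem_nhds (hop.mem_nhds (x := q)
      ⟨by simpa [dist_eq_norm] using h2, h1⟩), self_mem_nhdsWithin] with y hy hy2
    exact ⟨Metric.ball_subset_closedBall hy.1, le_of_lt hy.2, le_trans hy2 hq.2.2⟩)
  rw [hΦ, spatialHessian_quadraticTest, timeDeriv_quadraticTest] at hFq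
  have hlow := hF.le_apply (by linarith) (α := a + b + 2 * b) (β := 2 * 0) (e := (0 : Space n))
    (by positivity) hδ (by simp) (by simp; linarith)
  simp only [mul_zero, zero_mul, zero_sub] at hlow hFq
  rw [hB] at hFq
  nlinarith

set_option maxHeartbeats 1000000 in
/-- If two parabolas lie below a supersolution, one of them touching at `p'`, then their slopes
differ at most by the distance of `p'` to the place where they agree. -/
theorem IsViscositySupersolution.norm_vertex_sub_le {n : ℕ} {lam Lam δ : ℝ}
    {F : Matrix (Fin n) (Fin n) ℝ → ℝ} {u : Space n × ℝ → ℝ}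
    (hLam : 1 ≤ Lam) (hF : EllipticNearZero lam Lam δ F)
    (hu : IsViscositySupersolution F u)
    (hc : ContinuousOn u (Metric.closedBall (0 : Space n) 1 ×ˢ (Set.univ : Set ℝ)))
    {m a b : ℝ} {v₀ v v' p' : Space n × ℝ} (ha : 0 < a) (hab : a ≤ b)
    {r ρ η : ℝ} (hr : 0 < r) (hη : 0 < η) (hηl : 16 * Lam * η ^ 2 = lam) (hηρ : η * ρ = 4 * r)
    (hδ : 2 * (b / η ^ 2) ≤ δ) (hδ' : 10 * b < δ)
    (hball : Metric.closedBall p'.1 ρ ⊆ Metric.ball 0 1) (ht' : -1 < p'.2 - ρ ^ 2) (ht : p'.2 ≤ 0)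
    (hge : ∀ ξ ∈ Metric.ball (0 : Space n) 1, ∀ τ ≤ p'.2,
      m + concaveParabola v₀ a (ξ, τ) + concaveParabola v b (ξ, τ) ≤ u (ξ, τ))
    (hge' : ∀ ξ ∈ Metric.ball (0 : Space n) 1, ∀ τ ≤ p'.2,
      m + concaveParabola v₀ a (ξ, τ) + concaveParabola v' b (ξ, τ) ≤ u (ξ, τ))
    (heq : u p' = m + concaveParabola v₀ a p' + concaveParabola v' b p')
    (hX : concaveParabola v' b p' - concaveParabola v b p' ≤ 2 * b * ‖v'.1 - v.1‖ * r) :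
    ‖v'.1 - v.1‖ ≤ 32 * r / η ^ 2 := by
  by_contra! hcon
  have hb : 0 < b := ha.trans_le hab
  have hρ : 0 < ρ := by
    by_contra! h
    nlinarith
  set σ := ‖v'.1 - v.1‖ with hσ
  have hσ0 : 0 < σ := lt_trans (by positivity) hcon
  have hη2 : 0 < η ^ 2 := by positivity
  have hσr : 32 * r ≤ σ * η ^ 2 := ((div_lt_iff₀ hη2).1 hcon).le
  have hηρ2 : η ^ 2 * ρ ^ 2 = 16 * r ^ 2 := by
    rw [← mul_pow, hηρ]; ring
  -- The direction in which the `v'` parabola drops fastest relative to the `v` parabola, at rate `b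
  -- * σ`.
  set e : Space n := -(σ⁻¹ • (v'.1 - v.1)) with he
  have hen : ‖e‖ = 1 := by
    rw [he, norm_neg, norm_smul, ← hσ, norm_inv, Real.norm_of_nonneg hσ0.le,
      inv_mul_cancel₀ hσ0.ne']
  have hein : ∀ y : Space n, inner ℝ (v'.1 - v.1) y = -(σ * inner ℝ e y) := fun y => by
    rw [he, inner_neg_left, inner_smul_left]
    simp
    field_simp
  -- The added term is positive at `p'` and nonpositive on the face of the strip where the inner
  -- product with `e` is `-4 * r`. On the opposite face, where it may be positive, the `v` parabola
  -- keeps `Φ` below `u`.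
  set Φ := quadraticTest m a b v₀ v' (4 * b) (b / η ^ 2) (4 * b) (4 * r) e p' with hΦ
  have hΦe : ∀ q, Φ q = m + concaveParabola v₀ a q + concaveParabola v' b q +
      b * ((inner ℝ e (q.1 - p'.1) + 4 * r) ^ 2 / η ^ 2 - 4 * ‖q.1 - p'.1‖ ^ 2 -
        4 * (p'.2 - q.2)) := fun q => by
    rw [hΦ, quadraticTest]; ring
  set K : Set (Space n × ℝ) := (Metric.closedBall p'.1 ρ ×ˢ Icc (p'.2 - ρ ^ 2) p'.2) ∩
    {q | |inner ℝ e (q.1 - p'.1)| ≤ 4 * r} with hK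
  have hKc : IsCompact K := ((isCompact_closedBall _ _).prod isCompact_Icc).inter_right
    (isClosed_le (continuous_const.inner (continuous_fst.sub continuous_const)).abs
      continuous_const)
  have hKQ : K ⊆ Q1 n := fun q hq =>
    ⟨hball hq.1.1, ht'.trans_le hq.1.2.1, hq.1.2.2.trans ht⟩
  have hpK : p' ∈ K := by
    refine ⟨⟨by simpa using hρ.le, by simp; positivity, le_rfl⟩, ?_⟩
    simp [hr.le]
  -- The largest value of the convex term on the strip equals the penalty at spatial distance `ρ` or
  -- at time lag `ρ ^ 2`, so the added term is nonpositive there.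
  have h64 : (8 * r) ^ 2 / η ^ 2 = 4 * ρ ^ 2 := by
    rw [div_eq_iff hη2.ne']; nlinarith
  obtain ⟨q, hqK, hlt, hFq⟩ := hu.exists_le_of_lt hc hKc hKQ (Φ := Φ)
    (contDiff_quadraticTest _ _ _ _ _ _ _ _ _ _ _) (p₀ := p') hpK (by
      rw [hΦe, heq]
      have : 0 < b * ((4 * r) ^ 2 / η ^ 2) := by positivity
      simpa using this) (by
    intro q hq hlt
    have hqb := hball hq.1.1
    have hq1 : ‖q.1 - p'.1‖ ≤ ρ := by simpa [dist_eq_norm] using hq.1.1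
    have hq2 := hq.1.2
    have hq3 := abs_le.1 (show |inner ℝ e (q.1 - p'.1)| ≤ 4 * r from hq.2)
    rw [hΦe] at hlt
    have hv := hge q.1 hqb q.2 hq2.2
    have hv' := hge' q.1 hqb q.2 hq2.2
    simp only [Prod.mk.eta] at hv hv'
    set y := inner ℝ e (q.1 - p'.1) with hy
    have hyb : (y + 4 * r) ^ 2 / η ^ 2 ≤ 4 * ρ ^ 2 := by
      rw [← h64]
      have : (y + 4 * r) ^ 2 ≤ (8 * r) ^ 2 := pow_le_pow_left₀ (by linarith) (by linarith) 2
      gcongr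
    have hpos : 0 < (y + 4 * r) ^ 2 / η ^ 2 - 4 * ‖q.1 - p'.1‖ ^ 2 - 4 * (p'.2 - q.2) := by
      by_contra! h
      have := mul_nonpos_of_nonneg_of_nonpos hb.le h
      linarith
    have hn : 0 ≤ ‖q.1 - p'.1‖ ^ 2 := by positivity
    have h1 : p'.2 - ρ ^ 2 < q.2 := by
      refine lt_of_le_of_ne hq2.1 fun h => ?_
      rw [← h] at hpos
      linarith
    have h2 : ‖q.1 - p'.1‖ < ρ := by
      refine lt_of_le_of_ne hq1 fun h => ?_
      rw [h] at hpos
      have := hq2.2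
      linarith
    have h3 : |y| < 4 * r := by
      refine abs_lt.2 ⟨lt_of_le_of_ne hq3.1 fun h => ?_, lt_of_le_of_ne hq3.2 fun h => ?_⟩
      · rw [← h] at hpos
        have := hq2.2
        simp at hpos
        linarith
      -- On this face the `v'` parabola has dropped `4 * b * σ * r` relative to its advantage at
      -- `p'`, which was at most `2 * b * σ * r`. The net deficit `2 * b * σ * r` outweighs the
      -- added term since `σ` is large.
      · have h5 := concaveParabola_sub_eq v v' b p' q
        rw [hein, ← hy, h] at h5
        have h6 : b * ((y + 4 * r) ^ 2 / η ^ 2 - 4 * ‖q.1 - p'.1‖ ^ 2 - 4 * (p'.2 - q.2)) ≤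
            b * (4 * ρ ^ 2) := by
          gcongr
          have := hq2.2
          linarith
        have h7 : b * (4 * ρ ^ 2) ≤ 2 * b * σ * r := by
          have : 32 * r * (2 * b * r) ≤ σ * η ^ 2 * (2 * b * r) := by gcongr
          refine le_of_mul_le_mul_right ?_ hη2
          calc b * (4 * ρ ^ 2) * η ^ 2 = 4 * b * (η ^ 2 * ρ ^ 2) := by ring
            _ = 32 * r * (2 * b * r) := by rw [hηρ2]; ring
            _ ≤ σ * η ^ 2 * (2 * b * r) := this
            _ = 2 * b * σ * r * η ^ 2 := by ring
        linarith
    have hop : IsOpen ((Metric.ball p'.1 ρ ×ˢ Ioi (p'.2 - ρ ^ 2)) ∩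
        {q : Space n × ℝ | |inner ℝ e (q.1 - p'.1)| < 4 * r}) :=
      (Metric.isOpen_ball.prod isOpen_Ioi).inter (isOpen_lt
        (continuous_const.inner (continuous_fst.sub continuous_const)).abs continuous_const)
    filter_upwards [mem_nhdsWithin_of_mem_nhds (hop.mem_nhds (x := q)
      ⟨⟨by simpa [dist_eq_norm] using h2, h1⟩, h3⟩), self_mem_nhdsWithin] with y hy hy2
    exact ⟨⟨Metric.ball_subset_closedBall hy.1.1, le_of_lt hy.1.2, le_trans hy2 hq.1.2.2⟩,
      le_of_lt (a := |inner ℝ e (y.1 - p'.1)|) hy.2⟩)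
  rw [hΦ, spatialHessian_quadraticTest, timeDeriv_quadraticTest] at hFq
  have hlow := hF.le_apply (by linarith) (α := a + b + 2 * (4 * b)) (β := 2 * (b / η ^ 2))
    (e := e) (by positivity) (by linarith) (by positivity) (by rw [hen]; simpa using hδ)
  -- The choice of `η` makes the gain from convexity along `e` beat both the loss `Lam * (a + 9 *
  -- b)` and the time derivative `a + 5 * b`.
  have h32 : lam * (2 * (b / η ^ 2)) = 32 * Lam * b := by
    rw [← hηl]; field_simp; ring
  rw [hen, one_pow, mul_one, h32] at hlow
  nlinarith

/-! ### First contact and membership in contact sets -/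

theorem le_of_forall_lt_before {n : ℕ} {u g : Space n × ℝ → ℝ} {t : ℝ}
    (hc : ContinuousOn u (Metric.closedBall (0 : Space n) 1 ×ˢ (Set.univ : Set ℝ)))
    (hg : Continuous g)
    (h : ∀ ξ ∈ Metric.ball (0 : Space n) 1, ∀ τ < t, g (ξ, τ) < u (ξ, τ)) :
    ∀ ξ ∈ Metric.ball (0 : Space n) 1, ∀ τ ≤ t, g (ξ, τ) ≤ u (ξ, τ) := by
  intro ξ hξ τ hτ
  have h1 : Tendsto (fun σ : ℝ => u (ξ, σ)) (𝓝[<] τ) (𝓝 (u (ξ, τ))) := by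
    have : Continuous fun σ : ℝ => u (ξ, σ) := by
      rw [← continuousOn_univ]
      exact hc.comp (Continuous.continuousOn (by fun_prop))
        fun σ _ => ⟨Metric.ball_subset_closedBall hξ, trivial⟩
    exact (this.tendsto τ).mono_left nhdsWithin_le_nhds
  have h2 : Tendsto (fun σ : ℝ => g (ξ, σ)) (𝓝[<] τ) (𝓝 (g (ξ, τ))) :=
    ((hg.comp (Continuous.prodMk_right ξ)).tendsto τ).mono_left nhdsWithin_le_nhds
  refine le_of_tendsto_of_tendsto h2 h1 ?_
  filter_upwards [self_mem_nhdsWithin] with σ hσ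
  exact (h ξ hξ σ (lt_of_lt_of_le hσ hτ)).le

/-- `g ≤ u` in the unit ball at times up to that of `p`, with equality at `p`. -/
def TouchesFromBelow {n : ℕ} (g u : Space n × ℝ → ℝ) (p : Space n × ℝ) : Prop :=
  (∀ ξ ∈ Metric.ball (0 : Space n) 1, ∀ τ ≤ p.2, g (ξ, τ) ≤ u (ξ, τ)) ∧ u p = g p

theorem concaveParabola_eq_add {n : ℕ} (v : Space n × ℝ) (a : ℝ) (p q : Space n × ℝ) :
    concaveParabola v a q = concaveParabola v a p + a * inner ℝ (v.1 - p.1) (q.1 - p.1) -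
      a / 2 * ‖q.1 - p.1‖ ^ 2 + a * (q.2 - p.2) := by
  unfold concaveParabola
  have h : ‖q.1 - v.1‖ ^ 2 = ‖p.1 - v.1‖ ^ 2 + 2 * inner ℝ (p.1 - v.1) (q.1 - p.1) +
      ‖q.1 - p.1‖ ^ 2 := by
    rw [← norm_add_sq_real]; congr 2; abel
  have h2 : inner ℝ (p.1 - v.1) (q.1 - p.1) = -inner ℝ (v.1 - p.1) (q.1 - p.1) := by
    rw [← inner_neg_left, neg_sub]
  rw [h, h2]
  ring

/-- A point where a sum of two concave parabolas contacts `u - inf u` belongs to the contact sets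
of all larger openings. -/
theorem mem_contactSet_of_contact_add {n : ℕ} {u : Space n × ℝ → ℝ} {a b a' : ℝ}
    {v₀ v p : Space n × ℝ} (hbd : BddBelow (u '' Q1 n)) (hp : p ∈ Q1 n) (ha : 0 < a) (hb : 0 < b)
    (haa : a + b ≤ a') (hv₀ : v₀.1 ∈ Metric.closedBall (0 : Space n) 1) (hv₀' : -1 ≤ v₀.2)
    (hv : v.1 ∈ Metric.closedBall (0 : Space n) 1) (hv' : -1 ≤ v.2)
    (hlt : ∀ ξ ∈ Metric.ball (0 : Space n) 1, ∀ τ < p.2, sInf (u '' Q1 n) +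
      concaveParabola v₀ a (ξ, τ) + concaveParabola v b (ξ, τ) < u (ξ, τ))
    (heq : u p = sInf (u '' Q1 n) + concaveParabola v₀ a p + concaveParabola v b p) :
    p ∈ contactSet a' (closure (Q1 n)) u := by
  have ha' : 0 < a' := by linarith
  have hpb : p.1 ∈ Metric.closedBall (0 : Space n) 1 := Metric.ball_subset_closedBall hp.1
  have hm : sInf (u '' Q1 n) ≤ u p := csInf_le hbd (mem_image_of_mem u hp)
  set m := sInf (u '' Q1 n) with hmdef
  -- The vertex `(y, s)` is fixed by requiring that the parabola of opening `a'` have the same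
  -- spatial gradient and value at `p` as the sum. Then `y` is a convex combination of `p.1`, `v₀.1`
  -- and `v.1`.
  set w : Space n := a • (v₀.1 - p.1) + b • (v.1 - p.1) with hw
  set y : Space n := p.1 + a'⁻¹ • w with hy
  have hyw : a' • (y - p.1) = w := by
    rw [hy, add_sub_cancel_left, smul_smul, mul_inv_cancel₀ ha'.ne', one_smul]
  set s := p.2 - (u p - m) / a' - ‖p.1 - y‖ ^ 2 / 2 with hs
  have hval : concaveParabola (y, s) a' p = u p - m := by
    simp only [concaveParabola, hs]
    field_simp
    ring
  have hyb : y ∈ Metric.closedBall (0 : Space n) 1 := by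
    have h1 : y = (a'⁻¹ * (a' - a - b)) • p.1 + ((a'⁻¹ * a) • v₀.1 + (a'⁻¹ * b) • v.1) := by
      have : p.1 = (a'⁻¹ * a') • p.1 := by rw [inv_mul_cancel₀ ha'.ne', one_smul]
      rw [hy, hw]
      nth_rewrite 1 [this]
      module
    rw [mem_closedBall_zero_iff] at hpb hv₀ hv ⊢
    rw [h1]
    have h2 : 0 ≤ a' - a - b := by linarith
    calc _ ≤ ‖(a'⁻¹ * (a' - a - b)) • p.1‖ + (‖(a'⁻¹ * a) • v₀.1‖ + ‖(a'⁻¹ * b) • v.1‖) :=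
          (norm_add_le _ _).trans (add_le_add_right (norm_add_le _ _) _)
      _ = (a'⁻¹ * (a' - a - b)) * ‖p.1‖ + ((a'⁻¹ * a) * ‖v₀.1‖ + (a'⁻¹ * b) * ‖v.1‖) := by
          simp only [norm_smul]
          rw [Real.norm_of_nonneg (by positivity), Real.norm_of_nonneg (by positivity),
            Real.norm_of_nonneg (by positivity)]
      _ ≤ (a'⁻¹ * (a' - a - b)) * 1 + ((a'⁻¹ * a) * 1 + (a'⁻¹ * b) * 1) := by gcongr
      _ = 1 := by field_simp; ring
  have hs0 : s ≤ 0 := by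
    have h1 : 0 ≤ (u p - m) / a' := div_nonneg (by linarith) ha'.le
    have h2 : 0 ≤ ‖p.1 - y‖ ^ 2 / 2 := by positivity
    have h3 : p.2 ≤ 0 := hp.2.2
    linarith
  -- By Cauchy-Schwarz, `a' * ‖p.1 - y‖ ^ 2` is at most the corresponding sum for `v₀` and `v`.
  -- Equality of the values at `p` then bounds `a' * (p.2 - s)` by the sum of the two weighted time
  -- lags, each vertex having time at least `-1`.
  have hs1 : -1 ≤ s := by
    have h1 : ‖w‖ ^ 2 ≤ a' * (a * ‖p.1 - v₀.1‖ ^ 2 + b * ‖p.1 - v.1‖ ^ 2) := by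
      have h3 : ‖w‖ ≤ a * ‖p.1 - v₀.1‖ + b * ‖p.1 - v.1‖ := by
        refine (norm_add_le _ _).trans (le_of_eq ?_)
        rw [norm_smul, norm_smul, Real.norm_of_nonneg ha.le, Real.norm_of_nonneg hb.le,
          norm_sub_rev, norm_sub_rev v.1]
      set A := ‖p.1 - v₀.1‖
      set B := ‖p.1 - v.1‖
      calc ‖w‖ ^ 2 ≤ (a * A + b * B) ^ 2 := pow_le_pow_left₀ (norm_nonneg _) h3 2
        _ = (a + b) * (a * A ^ 2 + b * B ^ 2) - a * b * (A - B) ^ 2 := by ring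
        _ ≤ (a + b) * (a * A ^ 2 + b * B ^ 2) := by
          have : 0 ≤ a * b * (A - B) ^ 2 := by positivity
          linarith
        _ ≤ a' * (a * A ^ 2 + b * B ^ 2) := by gcongr
    have h2 : a' ^ 2 * ‖p.1 - y‖ ^ 2 = ‖w‖ ^ 2 := by
      rw [← hyw, norm_smul, norm_sub_rev, Real.norm_of_nonneg ha'.le]; ring
    have h4 : a' * ‖p.1 - y‖ ^ 2 ≤ a * ‖p.1 - v₀.1‖ ^ 2 + b * ‖p.1 - v.1‖ ^ 2 := by
      refine le_of_mul_le_mul_left ?_ ha'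
      calc a' * (a' * ‖p.1 - y‖ ^ 2) = a' ^ 2 * ‖p.1 - y‖ ^ 2 := by ring
        _ ≤ _ := h2 ▸ h1
    have h5 : a' * (p.2 - s) = (u p - m) + a' * ‖p.1 - y‖ ^ 2 / 2 := by
      rw [hs]; field_simp; ring
    have h6 : u p - m = -(a / 2) * ‖p.1 - v₀.1‖ ^ 2 + a * (p.2 - v₀.2) +
        (-(b / 2) * ‖p.1 - v.1‖ ^ 2 + b * (p.2 - v.2)) := by
      rw [heq]; simp only [concaveParabola]; ring
    have h7 : a' * (p.2 - s) ≤ a * (p.2 - v₀.2) + b * (p.2 - v.2) := by linarith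
    have h8 : a * (p.2 - v₀.2) ≤ a * (p.2 + 1) := by gcongr; linarith
    have h9 : b * (p.2 - v.2) ≤ b * (p.2 + 1) := by gcongr; linarith
    have h10 : 0 < p.2 + 1 := by have := hp.2.1; linarith
    have h11 : (a + b) * (p.2 + 1) ≤ a' * (p.2 + 1) := by gcongr
    have h12 : p.2 - s ≤ p.2 + 1 := le_of_mul_le_mul_left (by linarith) ha'
    linarith
  have hcl : closure (Q1 n) = Metric.closedBall 0 1 ×ˢ Icc (-1) 0 := by
    rw [Q1, closure_prod_eq, closure_ball _ one_ne_zero, closure_Ioc (by norm_num)]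
  refine ⟨hpb, (y, s), hcl ▸ ⟨hyb, hs1, hs0⟩, ?_, hval⟩
  -- Expanded about `p`, the two sides share value and gradient; the larger opening only lowers the
  -- parabola away from `p.1` and at earlier times.
  intro ξ hξ τ hτ
  have h1 := hlt ξ hξ τ hτ
  rw [concaveParabola_eq_add v₀ a p, concaveParabola_eq_add v b p] at h1
  rw [concaveParabola_eq_add (y, s) a' p, hval]
  simp only at h1 ⊢
  have h2 : a' * inner ℝ (y - p.1) (ξ - p.1) =
      a * inner ℝ (v₀.1 - p.1) (ξ - p.1) + b * inner ℝ (v.1 - p.1) (ξ - p.1) := by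
    have := congrArg (fun z => inner ℝ z (ξ - p.1)) hyw
    simpa [hw, inner_add_left, inner_smul_left] using this
  have h3 : (a + b) * ‖ξ - p.1‖ ^ 2 ≤ a' * ‖ξ - p.1‖ ^ 2 := by gcongr
  have h4 : (a + b) * (p.2 - τ) ≤ a' * (p.2 - τ) := by
    have : 0 ≤ p.2 - τ := by linarith
    gcongr
  linarith

/-- A concave parabola that is raised above `u` somewhere contacts `u` from below in its positivity
cone. -/
theorem exists_contact_add {n : ℕ} {u : Space n × ℝ → ℝ}
    (hc : ContinuousOn u (Metric.closedBall (0 : Space n) 1 ×ˢ (Set.univ : Set ℝ)))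
    {m a b H s t ρ : ℝ} {v₀ v : Space n × ℝ} {z : Space n} (hb : 0 < b) (hH : 0 < H) (hst : s < t)
    (hlt : ∀ ξ ∈ Metric.ball (0 : Space n) 1, ∀ τ < t,
      m + concaveParabola v₀ a (ξ, τ) < u (ξ, τ))
    (hz : u (z, s) ≤ m + concaveParabola v₀ a (z, s) + H) (hv : H ≤ concaveParabola v b (z, s))
    (hρ0 : 0 ≤ ρ) (hρ : 2 * (s - v.2) ≤ ρ ^ 2)
    (hball : Metric.closedBall v.1 ρ ⊆ Metric.ball 0 1) :
    ∃ p : Space n × ℝ, p.1 ∈ Metric.closedBall v.1 ρ ∧ p.2 ∈ Icc v.2 s ∧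
      (∀ ξ ∈ Metric.ball (0 : Space n) 1, ∀ τ < p.2,
        m + concaveParabola v₀ a (ξ, τ) + concaveParabola v b (ξ, τ) < u (ξ, τ)) ∧
      u p = m + concaveParabola v₀ a p + concaveParabola v b p := by
  have hg : Continuous fun q => m + concaveParabola v₀ a q + concaveParabola v b q :=
    (continuous_const.add (contDiff_concaveParabola (k := 0) v₀ a).continuous).add
      (contDiff_concaveParabola (k := 0) v b).continuous
  -- Before time `t` the first parabola is strictly below `u`, so the sum can reach `u` only where
  -- the added parabola is positive. That cone, up to time `s`, lies in a compact cylinder, which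
  -- gives an earliest contact time.
  have hcone : ∀ ξ τ, 0 < concaveParabola v b (ξ, τ) → τ ≤ s → ξ ∈ Metric.closedBall v.1 ρ ∧
      τ ∈ Icc v.2 s := by
    intro ξ τ h hτ
    have h1 : b / 2 * ‖ξ - v.1‖ ^ 2 < b / 2 * (2 * (τ - v.2)) := by
      simp only [concaveParabola] at h; linarith
    have h2 := lt_of_mul_lt_mul_left h1 (by positivity)
    have h3 : 0 ≤ ‖ξ - v.1‖ ^ 2 := by positivity
    refine ⟨?_, by linarith, hτ⟩
    rw [mem_closedBall_iff_norm]
    exact le_of_sq_le_sq (by linarith) hρ0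
  have hcyl : IsCompact (Metric.closedBall v.1 ρ ×ˢ Icc v.2 s) :=
    (isCompact_closedBall _ _).prod isCompact_Icc
  have hcc : ContinuousOn u (Metric.closedBall v.1 ρ ×ˢ Icc v.2 s) :=
    hc.mono fun q hq => ⟨Metric.ball_subset_closedBall (hball hq.1), trivial⟩
  have hK : IsCompact {q ∈ Metric.closedBall v.1 ρ ×ˢ Icc v.2 s |
      u q ≤ m + concaveParabola v₀ a q + concaveParabola v b q} :=
    hcyl.of_isClosed_subset (hcyl.isClosed.isClosed_le hcc hg.continuousOn) fun q hq => hq.1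
  obtain ⟨p, hp, hmin⟩ := hK.exists_isMinOn
    ⟨(z, s), hcone z s (hH.trans_le hv) le_rfl, by linarith⟩ continuous_snd.continuousOn
  have hstr : ∀ ξ ∈ Metric.ball (0 : Space n) 1, ∀ τ < p.2,
      m + concaveParabola v₀ a (ξ, τ) + concaveParabola v b (ξ, τ) < u (ξ, τ) := by
    intro ξ hξ τ hτ
    by_contra! h
    have h1 := hlt ξ hξ τ (hτ.trans_le (hp.1.2.2.trans hst.le))
    have h2 := hcone ξ τ (by linarith) (hτ.le.trans hp.1.2.2)
    have h3 : p.2 ≤ τ := hmin (show ((ξ, τ) : Space n × ℝ) ∈ _ from ⟨h2, h⟩)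
    linarith
  refine ⟨p, hp.1.1, hp.1.2, hstr, le_antisymm hp.2 ?_⟩
  exact le_of_forall_lt_before hc hg hstr p.1 (hball hp.1.1) p.2 le_rfl

/-! ### Dependence of the vertex on the contact point -/

/-- Forward comparison bounds the difference of the parabolas at the later point `p` from above;
touching at the earlier `p'` makes it nonnegative there. The difference being affine, its values at
the two points differ by at most `b * r` times the slope, so a slope bound closes the estimate. -/
theorem IsViscositySupersolution.vertex_sub_le_of_le {n : ℕ} {lam Lam δ : ℝ}
    {F : Matrix (Fin n) (Fin n) ℝ → ℝ} {u : Space n × ℝ → ℝ}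
    (hlam : 0 < lam) (hlam1 : lam ≤ 1) (hLam : 1 ≤ Lam) (hF : EllipticNearZero lam Lam δ F)
    (hu : IsViscositySupersolution F u)
    (hc : ContinuousOn u (Metric.closedBall (0 : Space n) 1 ×ˢ (Set.univ : Set ℝ)))
    {m a b : ℝ} {v₀ v v' p p' : Space n × ℝ} (ha : 0 < a) (hab : a ≤ b)
    (hδ : 32 * b * Lam / lam ≤ δ) {r ρ : ℝ} (hr : 0 < r)
    (hrρ : 16 * r * √(Lam / lam) ≤ ρ)
    (hball : Metric.closedBall p'.1 ρ ⊆ Metric.ball 0 1) (ht' : -1 < p'.2 - ρ ^ 2) (ht : p.2 ≤ 0)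
    (h : TouchesFromBelow
      (fun q => m + concaveParabola v₀ a q + concaveParabola v b q) u p)
    (h' : TouchesFromBelow
      (fun q => m + concaveParabola v₀ a q + concaveParabola v' b q) u p')
    (hσ : 2 * ‖v'.1 - v.1‖ ≤ ρ)
    (hX : 2 * (concaveParabola v' b p' - concaveParabola v b p') ≤ b * ρ ^ 2)
    (hx : ‖p.1 - p'.1‖ ≤ r) (htt : p'.2 ≤ p.2) (htr : p.2 - p'.2 ≤ r ^ 2) :
    ‖v'.1 - v.1‖ ≤ 512 * Lam / lam * r ∧
      |concaveParabola v' b p - concaveParabola v b p| ≤ 1033 * Lam / lam * b * r ^ 2 ∧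
      |concaveParabola v' b p' - concaveParabola v b p'| ≤ 1033 * Lam / lam * b * r ^ 2 := by
  have hb : 0 < b := ha.trans_le hab
  have hLl : Lam ≤ Lam / lam := (le_div_iff₀ hlam).2 (by nlinarith)
  have hLl1 : 1 ≤ Lam / lam := hLam.trans hLl
  set k := Lam / lam with hk
  have hk0 : 0 < k := by positivity
  have hsq : 1 ≤ √k := Real.one_le_sqrt.2 hLl1
  have hbk : b ≤ b * k := by nlinarith
  have hδ1 : 32 * (b * k) ≤ δ := by
    refine le_trans (le_of_eq ?_) hδ
    rw [hk]; ring
  have hrρ' : r ≤ ρ := by nlinarith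
  have hσ0 : 0 ≤ ‖v'.1 - v.1‖ := norm_nonneg _
  set X := concaveParabola v' b p - concaveParabola v b p with hXd
  set X' := concaveParabola v' b p' - concaveParabola v b p' with hXd'
  have hp'b : p'.1 ∈ Metric.ball (0 : Space n) 1 :=
    hball (Metric.mem_closedBall_self (hr.le.trans hrρ'))
  have hρ2 : 0 ≤ ρ ^ 2 := by positivity
  have h0 : 0 ≤ X' := by
    have h1 := h.1 p'.1 hp'b p'.2 htt
    have h2 := h'.2
    simp only [Prod.mk.eta] at h1 h2
    linarith
  have h1 : X ≤ 9 * Lam * b * r ^ 2 := by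
    have h2 := hu.concaveParabola_sub_le hLam hF hc (m := m) (v₀ := v₀) ha hb (by linarith)
      (hx.trans hrρ') htt hball (by linarith) ht
      (fun ξ hξ τ hτ => h.1 ξ hξ τ hτ.2) (fun ξ hξ => h'.1 ξ hξ _ le_rfl) h.2 hσ hX
    have h3 : b * ‖p.1 - p'.1‖ ^ 2 ≤ b * r ^ 2 := by gcongr
    have h4 : (2 * Lam * b + (Lam + 2) * (a + b)) * (p.2 - p'.2) ≤
        (2 * Lam * b + (Lam + 2) * (b + b)) * r ^ 2 := by
      gcongr
    have h5 : b * r ^ 2 ≤ Lam * (b * r ^ 2) := le_mul_of_one_le_left (by positivity) hLam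
    linarith
  have hXX : |X' - X| ≤ b * (‖v'.1 - v.1‖ * r) := by
    have h2 := concaveParabola_sub_eq v v' b p p'
    rw [← hXd, ← hXd'] at h2
    rw [h2, add_sub_cancel_left, abs_mul, abs_of_pos hb]
    gcongr
    refine (abs_real_inner_le_norm _ _).trans ?_
    rw [norm_sub_rev p'.1]
    gcongr
  have hmain : ‖v'.1 - v.1‖ ≤ 512 * k * r := by
    -- Either the vertices are already close, or `9 * Lam * b * r ^ 2` is absorbed into `b * ‖v'.1 -
    -- v.1‖ * r`, which gives the hypothesis with factor `2` of `norm_vertex_sub_le`.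
    rcases le_total ‖v'.1 - v.1‖ (9 * Lam * r) with h2 | h2
    · nlinarith
    · set η := (4 * √k)⁻¹ with hη
      have hη2 : η ^ 2 = (16 * k)⁻¹ := by
        rw [hη, inv_pow, mul_pow, Real.sq_sqrt hk0.le]; norm_num
      have hηpos : 0 < η := by positivity
      have h5 : b * (9 * Lam * r) * r ≤ b * ‖v'.1 - v.1‖ * r := by gcongr
      have h6 := (abs_le.1 hXX).2
      have := hu.norm_vertex_sub_le hLam hF hc (m := m) (v₀ := v₀) (v := v) (v' := v') (p' := p')
        (ρ := 16 * r * √k)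
        ha hab hr hηpos (by rw [hη2, hk]; field_simp) (by rw [hη]; field_simp; norm_num)
        (by rw [hη2]; field_simp; linarith) (by linarith)
        ((Metric.closedBall_subset_closedBall hrρ).trans hball)
        (by have := pow_le_pow_left₀ (by positivity) hrρ 2; linarith) (by linarith)
        (fun ξ hξ τ hτ => h.1 ξ hξ τ (hτ.trans htt)) h'.1 h'.2
        (by rw [← hXd']; linarith)
      rw [hη2] at this
      calc _ ≤ _ := this
        _ = 512 * k * r := by field_simp; norm_num
  have h7 : b * (‖v'.1 - v.1‖ * r) ≤ b * (512 * k * r * r) := by gcongr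
  have h8 : 9 * Lam * b * r ^ 2 ≤ 9 * k * b * r ^ 2 := by gcongr
  have h9 : 0 ≤ k * b * r ^ 2 := by positivity
  have h10 := abs_le.1 hXX
  have h11 : 1033 * Lam / lam * b * r ^ 2 = 1033 * (k * b * r ^ 2) := by rw [hk]; ring
  rw [h11]
  refine ⟨by rw [mul_div_assoc]; exact hmain, abs_le.2 ⟨?_, ?_⟩, abs_le.2 ⟨?_, ?_⟩⟩ <;> linarith

/-- The vertices of parabolas that touch a supersolution from below at nearby points lie in a
sheared parabolic cylinder of comparable size. -/
theorem IsViscositySupersolution.vertex_sub_le {n : ℕ} {lam Lam δ : ℝ}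
    {F : Matrix (Fin n) (Fin n) ℝ → ℝ} {u : Space n × ℝ → ℝ}
    (hlam : 0 < lam) (hlam1 : lam ≤ 1) (hLam : 1 ≤ Lam) (hF : EllipticNearZero lam Lam δ F)
    (hu : IsViscositySupersolution F u)
    (hc : ContinuousOn u (Metric.closedBall (0 : Space n) 1 ×ˢ (Set.univ : Set ℝ)))
    {m a b : ℝ} {v₀ v v' p p' : Space n × ℝ} (ha : 0 < a) (hab : a ≤ b)
    (hδ : 32 * b * Lam / lam ≤ δ) {r ρ : ℝ} (hr : 0 < r)
    (hrρ : 16 * r * √(Lam / lam) ≤ ρ)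
    (hball : Metric.closedBall p.1 ρ ⊆ Metric.ball 0 1) (hs : -1 < p.2 - ρ ^ 2) (ht : p.2 ≤ 0)
    (hball' : Metric.closedBall p'.1 ρ ⊆ Metric.ball 0 1) (hs' : -1 < p'.2 - ρ ^ 2)
    (ht' : p'.2 ≤ 0)
    (h : TouchesFromBelow
      (fun q => m + concaveParabola v₀ a q + concaveParabola v b q) u p)
    (h' : TouchesFromBelow
      (fun q => m + concaveParabola v₀ a q + concaveParabola v' b q) u p')
    (hσ : 2 * ‖v'.1 - v.1‖ ≤ ρ)
    (hX : 2 * |concaveParabola v' b p - concaveParabola v b p| ≤ b * ρ ^ 2)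
    (hX' : 2 * |concaveParabola v' b p' - concaveParabola v b p'| ≤ b * ρ ^ 2)
    (hx : ‖p.1 - p'.1‖ ≤ r) (htr : |p.2 - p'.2| ≤ r ^ 2) :
    ‖v'.1 - v.1‖ ≤ 512 * Lam / lam * r ∧
      |v'.2 - v.2 + (‖p.1 - v'.1‖ ^ 2 - ‖p.1 - v.1‖ ^ 2) / 2| ≤ 1033 * Lam / lam * r ^ 2 := by
  have hb : 0 < b := ha.trans_le hab
  suffices H : ‖v'.1 - v.1‖ ≤ 512 * Lam / lam * r ∧
      |concaveParabola v' b p - concaveParabola v b p| ≤ 1033 * Lam / lam * b * r ^ 2 by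
    refine ⟨H.1, ?_⟩
    -- Divided by `-b`, the difference at `p` is the time gap of the vertices corrected by a
    -- function of their spatial parts. This correction is the shear.
    have h1 : concaveParabola v' b p - concaveParabola v b p =
        -(b * (v'.2 - v.2 + (‖p.1 - v'.1‖ ^ 2 - ‖p.1 - v.1‖ ^ 2) / 2)) := by
      simp only [concaveParabola]; ring
    have h2 := H.2
    rw [h1, abs_neg, abs_mul, abs_of_pos hb] at h2
    exact le_of_mul_le_mul_left (by linarith) hb
  rcases le_total p'.2 p.2 with htt | htt
  · have := hu.vertex_sub_le_of_le hlam hlam1 hLam hF hc ha hab hδ hr hrρ hball' hs' ht h h' hσ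
      (by have := le_abs_self (concaveParabola v' b p' - concaveParabola v b p'); linarith)
      hx htt (by have := le_abs_self (p.2 - p'.2); linarith)
    exact ⟨this.1, this.2.1⟩
  · have := hu.vertex_sub_le_of_le hlam hlam1 hLam hF hc ha hab hδ hr hrρ hball hs ht' h' h
      (by rwa [norm_sub_rev])
      (by
        have := neg_abs_le (concaveParabola v' b p - concaveParabola v b p)
        linarith)
      (by rwa [norm_sub_rev]) htt (by have := neg_abs_le (p.2 - p'.2); linarith)
    rw [norm_sub_rev, abs_sub_comm (concaveParabola v b p)] at this
    exact ⟨this.1, this.2.2⟩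

/-! ### Measure estimate by parabolic grids -/

/-- Cells of the parabolic grid, of side `N⁻¹` in space and `N⁻²` in time. -/
def parabolicCell {n : ℕ} (N : ℕ) (k : (Fin n → ℤ) × ℤ) : Set (Space n × ℝ) :=
  {q | (∀ i, ⌊(N : ℝ) * q.1 i⌋ = k.1 i) ∧ ⌊(N : ℝ) ^ 2 * q.2⌋ = k.2}

theorem setOf_floor_mul_eq {c : ℝ} (hc : 0 < c) (k : ℤ) :
    {t : ℝ | ⌊c * t⌋ = k} = Ico (k / c) ((k + 1) / c) := by
  ext t
  simp only [mem_ofPred_eq, Int.floor_eq_iff, mem_Ico, div_le_iff₀ hc, lt_div_iff₀ hc, mul_comm c]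

theorem parabolicCell_eq_prod {n N : ℕ} (hN : 0 < N) (k : (Fin n → ℤ) × ℤ) :
    parabolicCell N k = ((WithLp.ofLp : Space n → Fin n → ℝ) ⁻¹'
      (univ.pi fun i => Ico ((k.1 i : ℝ) / N) ((k.1 i + 1) / N))) ×ˢ
        Ico ((k.2 : ℝ) / (N : ℝ) ^ 2) ((k.2 + 1) / (N : ℝ) ^ 2) := by
  have hN' : (0 : ℝ) < N := by exact_mod_cast hN
  ext q
  rw [← setOf_floor_mul_eq (by positivity)]
  simp only [← setOf_floor_mul_eq hN']
  simp [parabolicCell]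

theorem measurableSet_parabolicCell {n N : ℕ} (hN : 0 < N) (k : (Fin n → ℤ) × ℤ) :
    MeasurableSet (parabolicCell N k) := by
  rw [parabolicCell_eq_prod hN]
  exact ((PiLp.volume_preserving_ofLp (Fin n)).measurable
    (MeasurableSet.univ_pi fun i => measurableSet_Ico)).prod measurableSet_Ico

theorem volume_parabolicCell {n N : ℕ} (hN : 0 < N) (k : (Fin n → ℤ) × ℤ) :
    volume (parabolicCell N k) = ENNReal.ofReal ((1 / N) ^ n * (1 / (N : ℝ) ^ 2)) := by
  have hN' : (0 : ℝ) < N := by exact_mod_cast hN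
  rw [parabolicCell_eq_prod hN, Measure.volume_eq_prod, Measure.prod_prod,
    (PiLp.volume_preserving_ofLp (Fin n)).measure_preimage
      (MeasurableSet.univ_pi fun i => measurableSet_Ico).nullMeasurableSet, Real.volume_pi_Ico,
    Real.volume_Ico, ENNReal.ofReal_mul (by positivity), ENNReal.ofReal_pow (by positivity)]
  congr 1
  · have : ∀ i, ((k.1 i : ℝ) + 1) / N - k.1 i / N = 1 / N := fun i => by ring
    simp [this]
  · congr 1; ring

theorem dist_le_of_mem_parabolicCell {n N : ℕ} (hN : 0 < N) {k : (Fin n → ℤ) × ℤ}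
    {p q : Space n × ℝ} (hp : p ∈ parabolicCell N k) (hq : q ∈ parabolicCell N k) :
    ‖p.1 - q.1‖ ≤ √n / N ∧ |p.2 - q.2| ≤ 1 / (N : ℝ) ^ 2 := by
  have hN' : (0 : ℝ) < N := by exact_mod_cast hN
  have key : ∀ {c s t : ℝ}, 0 < c → ⌊c * s⌋ = ⌊c * t⌋ → |s - t| ≤ 1 / c := fun {c s t} hc h => by
    have := Int.abs_sub_lt_one_of_floor_eq_floor h
    rw [← mul_sub, abs_mul, abs_of_pos hc] at this
    rw [le_div_iff₀ hc]
    linarith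
  constructor
  · have h1 : ∀ i, ‖(p.1 - q.1) i‖ ^ 2 ≤ (1 / (N : ℝ)) ^ 2 := fun i =>
      pow_le_pow_left₀ (norm_nonneg _) (key hN' ((hp.1 i).trans (hq.1 i).symm)) 2
    rw [EuclideanSpace.norm_eq]
    refine Real.sqrt_le_iff.2 ⟨by positivity, ?_⟩
    refine (Finset.sum_le_sum fun i _ => h1 i).trans (le_of_eq ?_)
    rw [Finset.sum_const, Finset.card_univ, Fintype.card_fin, nsmul_eq_mul, div_pow, div_pow,
      Real.sq_sqrt (Nat.cast_nonneg n)]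
    ring
  · exact key (by positivity) (hp.2.trans hq.2.symm)

theorem volume_setOf_abs_sub_le {n : ℕ} (y : Space n) {r h : ℝ} (hr : 0 ≤ r) (hh : 0 < h)
    {g : Space n → ℝ} (hg : Continuous g) :
    volume {q : Space n × ℝ | ‖q.1 - y‖ ≤ r ∧ |q.2 - g q.1| ≤ h} ≤
      ENNReal.ofReal (r ^ n * (4 * h)) * volume (Metric.ball (0 : Space n) 1) := by
  -- `regionBetween` is open in the fibre, so the half-height is doubled; hence `4 * h` in the
  -- bound.
  have hsub : {q : Space n × ℝ | ‖q.1 - y‖ ≤ r ∧ |q.2 - g q.1| ≤ h} ⊆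
      regionBetween (fun x => g x - 2 * h) (fun x => g x + 2 * h) (Metric.closedBall y r) := by
    rintro q ⟨h1, h2⟩
    have h3 := abs_le.1 h2
    exact ⟨mem_closedBall_iff_norm.2 h1, by simp only; linarith, by simp only; linarith⟩
  refine (measure_mono hsub).trans (le_of_eq ?_)
  rw [Measure.volume_eq_prod, volume_regionBetween_eq_lintegral'
    (f := fun x => g x - 2 * h) (g := fun x => g x + 2 * h)
    (hg.sub continuous_const).measurable (hg.add continuous_const).measurable
    Metric.isClosed_closedBall.measurableSet]
  have : ∀ x, ((fun x => g x + 2 * h) - fun x => g x - 2 * h) x = 4 * h := fun x => by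
    simp only [Pi.sub_apply]; ring
  simp only [this, lintegral_const, Measure.restrict_apply_univ]
  rw [Measure.addHaar_closedBall _ _ hr, finrank_euclideanSpace_fin,
    ENNReal.ofReal_mul (p := r ^ n) (by positivity)]
  ring

/-- If points of `A` with labels in `V` that are parabolically close have labels in a sheared
parabolic cylinder of comparable size, the measure of `V` is controlled by that of `A`. -/
theorem volume_le_mul_volume_of_sheared {n : ℕ} (hn : 1 ≤ n) {V A : Set (Space n × ℝ)}
    {c : Space n × ℝ → Space n × ℝ} (hcA : MapsTo c V A) {L L' r₀ : ℝ} (hL : 0 ≤ L) (hL' : 0 < L')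
    (hr₀ : 0 < r₀) {g : Space n × ℝ → Space n → ℝ} (hg : ∀ v, Continuous (g v))
    (h : ∀ v ∈ V, ∀ v' ∈ V, ∀ r, 0 < r → r ≤ r₀ → ‖(c v).1 - (c v').1‖ ≤ r →
      |(c v).2 - (c v').2| ≤ r ^ 2 → ‖v'.1 - v.1‖ ≤ L * r ∧ |v'.2 - g v v'.1| ≤ L' * r ^ 2) :
    volume V ≤ ENNReal.ofReal ((L * √n) ^ n * (4 * (L' * n))) *
      volume (Metric.ball (0 : Space n) 1) * volume A := by
  set C := ENNReal.ofReal ((L * √n) ^ n * (4 * (L' * n))) *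
    volume (Metric.ball (0 : Space n) 1) with hC
  have hCtop : C ≠ ⊤ := ENNReal.mul_ne_top ENNReal.ofReal_ne_top measure_ball_lt_top.ne
  have hn1 : (1 : ℝ) ≤ n := by exact_mod_cast hn
  have hsn : 0 < √(n : ℝ) := by positivity
  -- With `r = √n / N`, the labels sent into one cell lie in a sheared cylinder whose volume is at
  -- most a fixed multiple of that of the cell.
  have hcell : ∀ N : ℕ, 0 < N → √n / N ≤ r₀ → ∀ k,
      volume {v ∈ V | c v ∈ parabolicCell N k} ≤ C * volume (parabolicCell (n := n) N k) := by
    intro N hN hNr k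
    have hN' : (0 : ℝ) < N := by exact_mod_cast hN
    rcases eq_empty_or_nonempty {v ∈ V | c v ∈ parabolicCell N k} with h0 | ⟨v, hv, hvk⟩
    · rw [h0]; simp
    · have hsub : {v ∈ V | c v ∈ parabolicCell N k} ⊆ {q : Space n × ℝ |
          ‖q.1 - v.1‖ ≤ L * (√n / N) ∧ |q.2 - g v q.1| ≤ L' * (√n / N) ^ 2} := by
        rintro v' ⟨hv', hvk'⟩
        have h1 := dist_le_of_mem_parabolicCell hN hvk hvk'
        refine h v hv v' hv' _ (by positivity) hNr h1.1 (h1.2.trans ?_)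
        rw [div_pow, Real.sq_sqrt (Nat.cast_nonneg n)]
        gcongr
      refine (measure_mono hsub).trans ((volume_setOf_abs_sub_le v.1 (by positivity)
        (by positivity) (hg v)).trans (le_of_eq ?_))
      rw [volume_parabolicCell hN, hC, mul_right_comm, ← ENNReal.ofReal_mul (by positivity)]
      congr 2
      rw [div_pow, Real.sq_sqrt (Nat.cast_nonneg n), one_div_pow, mul_pow, mul_pow, div_pow]
      ring
  have hopen : ∀ U, IsOpen U → A ⊆ U → volume V ≤ C * volume U := by
    intro U hU hAU
    -- Labels whose cells lie in `U` for every grid from the `j`-th on. These sets increase to `V`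
    -- because `U` is open, and continuity along an increasing union holds for outer measure, so
    -- neither `V`, `A` nor `c` need be measurable.
    set W : ℕ → Set (Space n × ℝ) := fun j =>
      {v ∈ V | ∀ N ≥ j, ∀ k, c v ∈ parabolicCell N k → parabolicCell N k ⊆ U} with hW
    have hmono : Monotone W := fun i j hij v hv => ⟨hv.1, fun N hN => hv.2 N (hij.trans hN)⟩
    have hVW : V ⊆ ⋃ j, W j := by
      intro v hv
      obtain ⟨ε, hε, hball⟩ := Metric.isOpen_iff.1 hU (c v) (hAU (hcA hv))
      obtain ⟨j, hj⟩ := exists_nat_gt (max (√n / ε) (1 / ε))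
      have hj1 := (le_max_left _ _).trans_lt hj
      have hj2 := (le_max_right _ _).trans_lt hj
      refine mem_iUnion.2 ⟨max j 1, hv, fun N hN k hk q hq => hball ?_⟩
      have hN1 : 1 ≤ N := (le_max_right _ _).trans hN
      have hNj : (j : ℝ) ≤ N := by exact_mod_cast (le_max_left _ _).trans hN
      have hN1' : (1 : ℝ) ≤ N := by exact_mod_cast hN1
      have hd := dist_le_of_mem_parabolicCell (by omega) hq hk
      have e1 : √n / N < ε := by
        rw [div_lt_iff₀ (by linarith)]
        rw [div_lt_iff₀ hε] at hj1
        nlinarith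
      have e2 : 1 / (N : ℝ) ^ 2 < ε := by
        rw [div_lt_iff₀ (by positivity)]
        rw [div_lt_iff₀ hε] at hj2
        have e3 : (j : ℝ) * ε ≤ N * ε := by gcongr
        have e4 : ε * N * 1 ≤ ε * N * N := by gcongr
        linarith
      rw [Metric.mem_ball, Prod.dist_eq, dist_eq_norm, Real.dist_eq]
      exact max_lt (hd.1.trans_lt e1) (hd.2.trans_lt e2)
    have hWj : ∀ j, volume (W j) ≤ C * volume U := by
      intro j
      obtain ⟨M, hM⟩ := exists_nat_gt (√n / r₀)
      set N := max (max j M) 1 with hNdef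
      have hNj : j ≤ N := (le_max_left _ _).trans (le_max_left _ _)
      have hN0 : 0 < N := (le_max_right (max j M) 1)
      have hNM : (M : ℝ) ≤ N := by exact_mod_cast (le_max_right j M).trans (le_max_left _ _)
      have hN' : (0 : ℝ) < N := by exact_mod_cast hN0
      have hNr : √n / N ≤ r₀ := by
        rw [div_le_iff₀ hN']
        rw [div_lt_iff₀ hr₀] at hM
        nlinarith
      have hsub : W j ⊆ ⋃ k : {k : (Fin n → ℤ) × ℤ // parabolicCell N k ⊆ U},
          {v ∈ V | c v ∈ parabolicCell N k.1} := by
        intro v hv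
        have hk : c v ∈ parabolicCell N
            ((fun i => ⌊(N : ℝ) * (c v).1 i⌋, ⌊(N : ℝ) ^ 2 * (c v).2⌋) : (Fin n → ℤ) × ℤ) :=
          ⟨fun _ => rfl, rfl⟩
        exact mem_iUnion.2 ⟨⟨_, hv.2 N hNj _ hk⟩, hv.1, hk⟩
      calc volume (W j) ≤ ∑' k : {k : (Fin n → ℤ) × ℤ // parabolicCell N k ⊆ U},
            volume {v ∈ V | c v ∈ parabolicCell N k.1} :=
            (measure_mono hsub).trans (measure_iUnion_le _)
        _ ≤ ∑' k : {k : (Fin n → ℤ) × ℤ // parabolicCell N k ⊆ U},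
            C * volume (parabolicCell (n := n) N k.1) :=
            ENNReal.tsum_le_tsum fun k => hcell N hN0 hNr k.1
        _ = C * volume (⋃ k : {k : (Fin n → ℤ) × ℤ // parabolicCell N k ⊆ U},
            parabolicCell N k.1) := by
            rw [ENNReal.tsum_mul_left, measure_iUnion (f := fun k :
              {k : (Fin n → ℤ) × ℤ // parabolicCell N k ⊆ U} => parabolicCell N k.1) ?_ fun k =>
              measurableSet_parabolicCell hN0 k.1]
            intro k k' hkk
            refine Set.disjoint_left.2 fun q hq hq' => hkk ?_
            exact Subtype.ext (Prod.ext (funext fun i => (hq.1 i).symm.trans (hq'.1 i))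
              (hq.2.symm.trans hq'.2))
        _ ≤ C * volume U := by
            gcongr
            exact iUnion_subset fun k => k.2
    calc volume V ≤ volume (⋃ j, W j) := measure_mono hVW
      _ = ⨆ j, volume (W j) := hmono.directed_le.measure_iUnion
      _ ≤ C * volume U := iSup_le hWj
  refine ENNReal.le_of_forall_pos_le_add fun ε hε _ => ?_
  have hε' : (ε : ENNReal) / (C + 1) ≠ 0 :=
    (ENNReal.div_pos (by exact_mod_cast hε.ne') (by simpa using hCtop)).ne'
  obtain ⟨U, hAU, hU, hvol⟩ := A.exists_isOpen_le_add volume hε'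
  calc volume V ≤ C * volume U := hopen U hU hAU
    _ ≤ C * (volume A + ε / (C + 1)) := by gcongr
    _ = C * volume A + C * (ε / (C + 1)) := mul_add _ _ _
    _ ≤ C * volume A + (C + 1) * (ε / (C + 1)) := by gcongr; exact le_self_add
    _ ≤ C * volume A + ε := by gcongr; exact ENNReal.mul_div_le

/-! ### Geometry of the intersection of parabolic balls -/

/-- Centers of two balls for a point `x` of an intersection of a forward and a backward parabolic
ball: one well inside the intersection, and one that contains `x` and stays in the base of
the backward parabolic ball. -/
theorem exists_centers {n : ℕ} {x₀ x₁ x : Space n} {ρ d e f : ℝ} (hρ : 0 < ρ)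
    (he : 0 < e) (hf : 0 ≤ f) (hede : e ^ 2 = d ^ 2 + ρ ^ 2) (hfd : f ^ 2 = d ^ 2 + 5 / 8 * ρ ^ 2)
    (h1 : ‖x - x₁‖ ≤ ρ) (h2 : ‖x - x₀‖ ≤ d) (h3 : ‖x₁ - x₀‖ ≤ e) :
    ∃ z c : Space n, ‖z - x₁‖ + 6 * (ρ / 128) ≤ ρ / 2 ∧ ‖z - x₀‖ + 6 * (ρ / 128) ≤ f ∧
      ‖x - c‖ < ρ / 128 ∧ ‖c - x₀‖ + ρ / 128 ≤ e ∧ ‖c - z‖ ≤ 2 * ρ := by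
  have hde : d < e := lt_of_pow_lt_pow_left₀ 2 he.le (by nlinarith)
  have hρe : ρ ≤ e := le_of_sq_le_sq (by nlinarith) he.le
  have hfe : f ≤ e := le_of_sq_le_sq (by nlinarith) he.le
  have hef : 3 / 4 * e ≤ f := le_of_sq_le_sq (by nlinarith) hf
  -- The point at three eighths of the segment from `x₁` to `x`; convexity of the square puts it
  -- within `f` of `x₀`, the radius of the backward ball at three eighths of the time span.
  set y : Space n := x₁ + (3 / 8 : ℝ) • (x - x₁) with hy
  have hyx₁ : ‖y - x₁‖ ≤ 3 / 8 * ρ := by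
    rw [hy, add_sub_cancel_left, norm_smul, Real.norm_of_nonneg (by norm_num)]
    gcongr
  have hxy : ‖x - y‖ ≤ 5 / 8 * ρ := by
    have : x - y = (5 / 8 : ℝ) • (x - x₁) := by rw [hy]; module
    rw [this, norm_smul, Real.norm_of_nonneg (by norm_num)]
    gcongr
  have hyx₀ : ‖y - x₀‖ ≤ f := by
    refine le_of_sq_le_sq ?_ hf
    have h4 : y - x₀ = (5 / 8 : ℝ) • (x₁ - x₀) + (3 / 8 : ℝ) • (x - x₀) := by rw [hy]; module
    have h5 : ‖y - x₀‖ ≤ 5 / 8 * ‖x₁ - x₀‖ + 3 / 8 * ‖x - x₀‖ := by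
      rw [h4]
      refine (norm_add_le _ _).trans (le_of_eq ?_)
      rw [norm_smul, norm_smul, Real.norm_of_nonneg (by norm_num),
        Real.norm_of_nonneg (by norm_num)]
    calc ‖y - x₀‖ ^ 2 ≤ (5 / 8 * ‖x₁ - x₀‖ + 3 / 8 * ‖x - x₀‖) ^ 2 := by gcongr
      _ ≤ (5 / 8 * e + 3 / 8 * d) ^ 2 := by gcongr
      _ ≤ 5 / 8 * e ^ 2 + 3 / 8 * d ^ 2 := by nlinarith [sq_nonneg (e - d)]
      _ = f ^ 2 := by rw [hfd, hede]; ring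
  -- Moving `y` and `x` towards `x₀` by the fractions `ε / 16` and `ε / 128` buys the margins: since
  -- `f ≥ 3 / 4 * e`, the first gains at least `3 / 64 * ρ`, exactly `6 * (ρ / 128)`.
  set ε := ρ / e with hε
  have hε0 : 0 < ε := by positivity
  have hε1 : ε ≤ 1 := (div_le_one he).2 hρe
  have hεe : ε * e = ρ := by rw [hε]; field_simp
  have hz : ∀ (k : ℝ) (w : Space n), 0 ≤ k → k ≤ 1 →
      ‖w + (k * ε) • (x₀ - w) - x₀‖ = (1 - k * ε) * ‖w - x₀‖ ∧
        ‖w + (k * ε) • (x₀ - w) - w‖ = k * ε * ‖w - x₀‖ := by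
    intro k w hk hk1
    have hkε : k * ε ≤ 1 := mul_le_one₀ hk1 hε0.le hε1
    constructor
    · have : w + (k * ε) • (x₀ - w) - x₀ = (1 - k * ε) • (w - x₀) := by module
      rw [this, norm_smul, Real.norm_of_nonneg (by linarith)]
    · rw [add_sub_cancel_left, norm_smul, Real.norm_of_nonneg (by positivity), norm_sub_rev]
  obtain ⟨z1, z2⟩ := hz (1 / 16) y (by norm_num) (by norm_num)
  obtain ⟨c1, c2⟩ := hz (1 / 128) x (by norm_num) (by norm_num)
  set z := y + (1 / 16 * ε) • (x₀ - y) with hzd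
  set c := x + (1 / 128 * ε) • (x₀ - x) with hcd
  have hzy : ‖z - y‖ ≤ ρ / 16 := by
    rw [z2]
    calc 1 / 16 * ε * ‖y - x₀‖ ≤ 1 / 16 * ε * e := by gcongr; exact hyx₀.trans hfe
      _ = ρ / 16 := by rw [← hεe]; ring
  have hcx : ‖c - x‖ < ρ / 128 := by
    rw [c2]
    calc 1 / 128 * ε * ‖x - x₀‖ ≤ 1 / 128 * ε * d := by gcongr
      _ < 1 / 128 * ε * e := by gcongr
      _ = ρ / 128 := by rw [← hεe]; ring
  refine ⟨z, c, ?_, ?_, by rwa [norm_sub_rev], ?_, ?_⟩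
  · have := norm_sub_le_norm_sub_add_norm_sub z y x₁
    linarith
  · rw [z1]
    have h4 : (1 - 1 / 16 * ε) * ‖y - x₀‖ ≤ (1 - 1 / 16 * ε) * f := by
      gcongr
      linarith
    have h5 : ε * (3 / 4 * e) ≤ ε * f := by gcongr
    linarith
  · rw [c1]
    have h4 : (1 - 1 / 128 * ε) * ‖x - x₀‖ ≤ (1 - 1 / 128 * ε) * d := by
      gcongr
      linarith
    have h5 : 0 ≤ (e - d) * (1 - 1 / 128 * ε) := mul_nonneg (by linarith) (by linarith)
    linarith
  · have h4 := norm_sub_le_norm_sub_add_norm_sub c x z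
    have h5 := norm_sub_le_norm_sub_add_norm_sub x y z
    rw [norm_sub_rev y z] at h5
    linarith

/-- The cylinder over `z` will hold the new contact points. The tube from `z` to `c` only needs
spatial room in the unit ball, hence the slice at time `t₁`. Starting the window at `T / 4` puts the
ball of radius `√(T / θ) / 2` about `x₁` inside the forward ball. -/
theorem exists_tube_and_window {n : ℕ} {θ T₀ T t₀ t₁ : ℝ} {x₀ x₁ x : Space n} (hθ : 0 < θ)
    (hT : 0 < T) (h₁ : (x₁, t₁) ∈ backwardPB θ T₀ x₀ t₀)
    (hx : (x, t₁ + T) ∈ forwardPB θ T x₁ t₁) (hx' : (x, t₁ + T) ∈ backwardPB θ T₀ x₀ t₀) :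
    ∃ (z c : Space n) (e : ℝ),
      Metric.closedBall z (6 * (√(T / θ) / 128)) ×ˢ Icc (t₁ + T / 4) (t₁ + 3 * T / 8) ⊆
        backwardPB θ T₀ x₀ t₀ ∩ forwardPB θ T x₁ t₁ ∧
      Metric.closedBall x₀ e ×ˢ {t₁} ⊆ backwardPB θ T₀ x₀ t₀ ∧
      ‖z - x₀‖ + √(T / θ) / 128 ≤ e ∧ ‖c - x₀‖ + √(T / θ) / 128 ≤ e ∧
      ‖x - c‖ < √(T / θ) / 128 ∧ ‖c - z‖ ≤ 2 * √(T / θ) := by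
  have a1 : θ * ‖x₁ - x₀‖ ^ 2 ≤ t₀ - t₁ ∧ t₀ - t₁ ≤ T₀ := h₁
  have a2 : θ * ‖x - x₁‖ ^ 2 ≤ t₁ + T - t₁ := hx.1
  have a3 : θ * ‖x - x₀‖ ^ 2 ≤ t₀ - (t₁ + T) := hx'.1
  rw [add_sub_cancel_left] at a2
  set D := t₀ - (t₁ + T) with hD
  have hDT : t₀ - t₁ = D + T := by rw [hD]; ring
  have hD0 : 0 ≤ D := le_trans (by positivity) a3
  rw [hDT] at a1
  have hsq : ∀ {k s : ℝ}, θ * k ^ 2 ≤ s → k ≤ √(s / θ) := fun {k s} h =>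
    Real.le_sqrt_of_sq_le ((le_div_iff₀ hθ).2 (by linarith))
  have e1 : √(T / θ) ^ 2 = T / θ := Real.sq_sqrt (by positivity)
  have e2 : √(D / θ) ^ 2 = D / θ := Real.sq_sqrt (by positivity)
  have e3 : √((D + T) / θ) ^ 2 = (D + T) / θ := Real.sq_sqrt (by positivity)
  have e4 : √((D + 5 / 8 * T) / θ) ^ 2 = (D + 5 / 8 * T) / θ := Real.sq_sqrt (by positivity)
  obtain ⟨z, c, b1, b2, b3, b4, b5⟩ := exists_centers (ρ := √(T / θ)) (d := √(D / θ))
    (e := √((D + T) / θ)) (f := √((D + 5 / 8 * T) / θ)) (by positivity) (by positivity)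
    (by positivity) (by rw [e1, e2, e3]; ring) (by rw [e1, e2, e4]; ring)
    (hsq a2) (hsq a3) (hsq a1.1)
  have hρ : 0 < √(T / θ) := by positivity
  refine ⟨z, c, √((D + T) / θ), ?_, ?_, ?_, b4, b3, b5⟩
  · rintro ⟨y, t⟩ ⟨hy, ht1, ht2⟩
    rw [mem_closedBall_iff_norm] at hy
    simp only at hy ht1 ht2
    have c1 : ‖y - x₁‖ ≤ √(T / θ) / 2 :=
      (norm_sub_le_norm_sub_add_norm_sub y z x₁).trans (by linarith)
    have c2 : ‖y - x₀‖ ≤ √((D + 5 / 8 * T) / θ) :=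
      (norm_sub_le_norm_sub_add_norm_sub y z x₀).trans (by linarith)
    have c3 := pow_le_pow_left₀ (norm_nonneg _) c1 2
    have c4 := pow_le_pow_left₀ (norm_nonneg _) c2 2
    rw [div_pow, e1, div_div, le_div_iff₀ (by positivity)] at c3
    rw [e4, le_div_iff₀ hθ] at c4
    refine ⟨⟨?_, ?_⟩, ?_, ?_⟩ <;> simp only <;> linarith
  · rintro ⟨y, t⟩ ⟨hy, rfl⟩
    rw [mem_closedBall_iff_norm] at hy
    have c4 := pow_le_pow_left₀ (norm_nonneg _) hy 2
    rw [e3, le_div_iff₀ hθ] at c4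
    refine ⟨?_, ?_⟩ <;> simp only at * <;> linarith
  · have : √((D + 5 / 8 * T) / θ) ≤ √((D + T) / θ) := Real.sqrt_le_sqrt (by gcongr; linarith)
    linarith

theorem volume_forwardPB_le {n : ℕ} {θ T t : ℝ} {x : Space n} (hθ : 0 < θ) (hT : 0 < T) :
    volume (forwardPB θ T x t) ≤
      ENNReal.ofReal (√(T / θ) ^ n * T) * volume (Metric.ball (0 : Space n) 1) := by
  have hsub : forwardPB θ T x t ⊆ Metric.closedBall x √(T / θ) ×ˢ Icc t (t + T) := by
    rintro q ⟨h1, h2⟩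
    have h3 : 0 ≤ θ * ‖q.1 - x‖ ^ 2 := by positivity
    refine ⟨?_, by linarith, by linarith⟩
    rw [mem_closedBall_iff_norm]
    exact Real.le_sqrt_of_sq_le ((le_div_iff₀ hθ).2 (by linarith))
  refine (measure_mono hsub).trans (le_of_eq ?_)
  rw [Measure.volume_eq_prod, Measure.prod_prod, Measure.addHaar_closedBall _ _ (by positivity),
    finrank_euclideanSpace_fin, Real.volume_Icc, add_sub_cancel_left,
    ENNReal.ofReal_mul (by positivity)]
  ring

/-! ### Choice of constants and conclusion -/

/-- The exponent `10 ^ 6` in `c0` exceeds the barrier's `700000` by enough to absorb the numerical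
factor `512`; the prefactor of `c0` cancels the powers of `Lam / lam`. -/
theorem opening_le_of_lt_c0_mul {n : ℕ} (hn : 1 ≤ n) {lam Lam δ a : ℝ} (hlam : 0 < lam)
    (hlam1 : lam ≤ 1) (hLam : 1 ≤ Lam) (hδ : 0 < δ) (ha : a < c0 n lam Lam * δ) :
    32 * (8 * (Real.exp (700000 * Lam ^ 2 / lam) * (1 + Lam) / lam * a)) * Lam / lam ≤ δ := by
  have hLam0 : 0 < Lam := by linarith
  have hn1 : (1 : ℝ) ≤ n := by exact_mod_cast hn
  set K := Lam * n / lam with hK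
  have hLK : Lam / lam ≤ K := by
    rw [hK]; gcongr; exact le_mul_of_one_le_right hLam0.le hn1
  have hLl : 1 ≤ Lam / lam := (le_div_iff₀ hlam).2 (by linarith)
  have hK2 : Lam ^ 2 / lam ≤ K ^ 2 := by
    calc Lam ^ 2 / lam = Lam ^ 2 / (lam * 1) := by ring
      _ ≤ Lam ^ 2 / (lam * lam) := by gcongr
      _ = (Lam / lam) ^ 2 := by ring
      _ ≤ K ^ 2 := by gcongr
  have hK1 : 1 ≤ K ^ 2 := one_le_pow₀ (hLl.trans hLK)
  set E := Real.exp (700000 * Lam ^ 2 / lam) with hE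
  set G := Real.exp (-(10 ^ 6 * K ^ 2)) with hG
  have hEpos : 0 < E := Real.exp_pos _
  have hGpos : 0 < G := Real.exp_pos _
  have hEG : E * G * 512 ≤ 1 := by
    have h1 : E * G ≤ Real.exp (-512) := by
      rw [hE, hG, ← Real.exp_add]
      refine Real.exp_le_exp.2 ?_
      have : 700000 * Lam ^ 2 / lam = 700000 * (Lam ^ 2 / lam) := by ring
      rw [this]
      linarith
    have h2 : Real.exp (-512) * 512 ≤ 1 := by
      rw [Real.exp_neg, inv_mul_le_iff₀ (Real.exp_pos _)]
      have := Real.add_one_le_exp (512 : ℝ)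
      linarith
    calc E * G * 512 ≤ Real.exp (-512) * 512 := by gcongr
      _ ≤ 1 := h2
  have hc : c0 n lam Lam = lam ^ 2 / (Lam ^ 2 * (n + 5)) * G := rfl
  calc 32 * (8 * (E * (1 + Lam) / lam * a)) * Lam / lam
      = 256 * E * (1 + Lam) * Lam / lam ^ 2 * a := by field_simp; ring
    _ ≤ 256 * E * (Lam + Lam) * Lam / lam ^ 2 * (c0 n lam Lam * δ) := by
        have : 0 ≤ c0 n lam Lam * δ := by rw [hc]; positivity
        calc _ ≤ 256 * E * (1 + Lam) * Lam / lam ^ 2 * (c0 n lam Lam * δ) := by gcongr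
          _ ≤ _ := by gcongr
    _ = (E * G * 512) / (n + 5) * δ := by rw [hc]; field_simp; ring
    _ ≤ 1 / 1 * δ := by gcongr; linarith
    _ = δ := by ring

/-- The measure of a contact set, bounded below by sliding the parabolas with vertices in a small
cylinder until they touch. -/
theorem IsViscositySupersolution.le_volume_contactSet {n : ℕ} (hn : 1 ≤ n) {lam Lam δ : ℝ}
    {F : Matrix (Fin n) (Fin n) ℝ → ℝ} {u : Space n × ℝ → ℝ}
    (hlam : 0 < lam) (hlam1 : lam ≤ 1) (hLam : 1 ≤ Lam) (hF : EllipticNearZero lam Lam δ F)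
    (hu : IsViscositySupersolution F u)
    (hc : ContinuousOn u (Metric.closedBall (0 : Space n) 1 ×ˢ (Set.univ : Set ℝ)))
    (hbd : BddBelow (u '' Q1 n)) {a b a' R s t σ : ℝ} {v₀ : Space n × ℝ} {z z₀ : Space n}
    {G : Set (Space n × ℝ)} (ha : 0 < a) (hab : a ≤ b) (haa : a + b ≤ a')
    (hδ : 32 * b * Lam / lam ≤ δ) (hR : 0 < R) (hst : s < t)
    (hv₀ : v₀.1 ∈ Metric.closedBall (0 : Space n) 1) (hv₀' : -1 ≤ v₀.2)
    (hlt : ∀ ξ ∈ Metric.ball (0 : Space n) 1, ∀ τ < t,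
      sInf (u '' Q1 n) + concaveParabola v₀ a (ξ, τ) < u (ξ, τ))
    (hGQ : G ⊆ Q1 n) (hcyl : Metric.closedBall z₀ (6 * R) ×ˢ Icc σ s ⊆ G)
    (hσ : σ ≤ s - 10 * R ^ 2) (hz : z ∈ Metric.closedBall z₀ R)
    (hzu : u (z, s) ≤ sInf (u '' Q1 n) + concaveParabola v₀ a (z, s) + b / 8 * R ^ 2) :
    ENNReal.ofReal ((R / 2) ^ n * (R ^ 2 / 4)) ≤
      ENNReal.ofReal ((512 * Lam / lam * √n) ^ n * (4 * (1033 * Lam / lam * n))) *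
        volume (contactSet a' (closure (Q1 n)) u ∩ G) := by
  have hb : 0 < b := ha.trans_le hab
  have hLam0 : 0 < Lam := by linarith
  have hR2 : 0 < R ^ 2 := by positivity
  set m := sInf (u '' Q1 n) with hm
  -- For these vertices the added parabola is at least `b * (R ^ 2 / 4 - R ^ 2 / 8)` at `(z, s)`,
  -- matching the gap in `hzu`, while its positivity cone up to time `s` has radius at most `R`.
  set V : Set (Space n × ℝ) :=
    Metric.closedBall z (R / 2) ×ˢ Icc (s - R ^ 2 / 2) (s - R ^ 2 / 4) with hV
  have hzz : ‖z - z₀‖ ≤ R := mem_closedBall_iff_norm.1 hz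
  have hball : ∀ (y : Space n) (r : ℝ), ‖y - z₀‖ + r ≤ 6 * R →
      Metric.closedBall y r ⊆ Metric.ball 0 1 := by
    intro y r hy x hx
    refine (hGQ (hcyl (a := (x, s)) ⟨?_, by simp only; linarith, le_rfl⟩)).1
    rw [mem_closedBall_iff_norm] at hx ⊢
    have := norm_sub_le_norm_sub_add_norm_sub x y z₀
    simp only
    linarith
  have hσ1 : -1 < σ := by
    have h : ((z₀, σ) : Space n × ℝ) ∈ Q1 n :=
      hGQ (hcyl ⟨Metric.mem_closedBall_self (by positivity), le_rfl, by simp only; linarith⟩)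
    exact h.2.1
  have hs0 : s ≤ 0 := by
    have h : ((z₀, s) : Space n × ℝ) ∈ Q1 n :=
      hGQ (hcyl ⟨Metric.mem_closedBall_self (by positivity), by simp only; linarith, le_rfl⟩)
    exact h.2.2
  have hVn : ∀ v ∈ V, ‖v.1 - z‖ ≤ R / 2 := fun v hv => mem_closedBall_iff_norm.1 hv.1
  have hVz : ∀ v ∈ V, ‖v.1 - z₀‖ ≤ 3 / 2 * R := fun v hv => by
    have := norm_sub_le_norm_sub_add_norm_sub v.1 z z₀
    have := hVn v hv
    linarith
  have hex : ∀ v : Space n × ℝ, ∃ p : Space n × ℝ, v ∈ V →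
      p.1 ∈ Metric.closedBall v.1 R ∧ p.2 ∈ Icc v.2 s ∧
      (∀ ξ ∈ Metric.ball (0 : Space n) 1, ∀ τ < p.2,
        m + concaveParabola v₀ a (ξ, τ) + concaveParabola v b (ξ, τ) < u (ξ, τ)) ∧
      u p = m + concaveParabola v₀ a p + concaveParabola v b p := by
    intro v
    by_cases hv : v ∈ V
    · obtain ⟨p, hp⟩ := exists_contact_add hc (m := m) (a := a) (b := b) (H := b / 8 * R ^ 2)
        (s := s) (t := t) (ρ := R) (v₀ := v₀) (v := v) (z := z) hb (by positivity) hst hlt hzu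
        (by
          have h1 := pow_le_pow_left₀ (norm_nonneg _) (hVn v hv) 2
          rw [norm_sub_rev] at h1
          have h2 := hv.2.2
          have h3 : b * (1 / 2 * ‖z - v.1‖ ^ 2 + R ^ 2 / 8) ≤ b * (s - v.2) := by
            gcongr
            linarith
          simp only [concaveParabola]
          linarith) hR.le (by have := hv.2.1; linarith)
        (hball v.1 R (by have := hVz v hv; linarith))
      exact ⟨p, fun _ => hp⟩
    · exact ⟨0, fun h => absurd h hv⟩
  choose c hcV using hex
  have hg : Continuous fun q => m + concaveParabola v₀ a q :=
    continuous_const.add (contDiff_concaveParabola (k := 0) v₀ a).continuous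
  have htouch : ∀ v ∈ V, TouchesFromBelow
      (fun q => m + concaveParabola v₀ a q + concaveParabola v b q) u (c v) := fun v hv =>
    ⟨le_of_forall_lt_before hc (hg.add (contDiff_concaveParabola (k := 0) v b).continuous)
      (hcV v hv).2.2.1, (hcV v hv).2.2.2⟩
  have hcn : ∀ v ∈ V, ‖(c v).1 - v.1‖ ≤ R := fun v hv => mem_closedBall_iff_norm.1 (hcV v hv).1
  have hcz : ∀ v ∈ V, ‖(c v).1 - z₀‖ ≤ 5 / 2 * R := fun v hv => by
    have := norm_sub_le_norm_sub_add_norm_sub (c v).1 v.1 z₀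
    have := hVz v hv
    have := hcn v hv
    linarith
  have hcs : ∀ v ∈ V, s - R ^ 2 / 2 ≤ (c v).2 ∧ (c v).2 ≤ s := fun v hv =>
    ⟨hv.2.1.trans (hcV v hv).2.1.1, (hcV v hv).2.1.2⟩
  have hcG : ∀ v ∈ V, c v ∈ G := fun v hv => hcyl ⟨by
    rw [mem_closedBall_iff_norm]; have := hcz v hv; linarith, by
    have := (hcs v hv).1; linarith, (hcs v hv).2⟩
  have hmaps : MapsTo c V (contactSet a' (closure (Q1 n)) u ∩ G) := fun v hv => by
    refine ⟨mem_contactSet_of_contact_add hbd (hGQ (hcG v hv)) ha hb haa hv₀ hv₀' ?_ ?_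
      (hcV v hv).2.2.1 (hcV v hv).2.2.2, hcG v hv⟩
    · exact Metric.ball_subset_closedBall (hball v.1 0 (by have := hVz v hv; linarith)
        (Metric.mem_closedBall_self le_rfl))
    · have := hv.2.1; linarith
  have hsq : 0 < √(Lam / lam) := by positivity
  -- Contact points lie within `5 / 2 * R` of `z₀`, so comparison cylinders of radius `3 * R` stay
  -- within `6 * R` and reach back less than `10 * R ^ 2` in time. The bound `r₀` makes `16 * r *
  -- √(Lam / lam) ≤ 3 * R`.
  have hvol := volume_le_mul_volume_of_sheared hn hmaps (L := 512 * Lam / lam)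
    (L' := 1033 * Lam / lam) (r₀ := 3 * R / (16 * √(Lam / lam))) (by positivity) (by positivity)
    (by positivity)
    (g := fun v x => v.2 - (‖(c v).1 - x‖ ^ 2 - ‖(c v).1 - v.1‖ ^ 2) / 2) (fun v => by fun_prop)
    (by
      intro v hv v' hv' r hr hr₀ hx ht
      have hvv : ‖v'.1 - v.1‖ ≤ R := by
        have h1 := norm_sub_le_norm_sub_add_norm_sub v'.1 z v.1
        have h2 := hVn v hv
        have h3 := hVn v' hv'
        rw [norm_sub_rev z] at h1
        linarith
      have hdiff : ∀ y : Space n × ℝ, ‖y.1 - v.1‖ ≤ 2 * R → ‖y.1 - v'.1‖ ≤ 2 * R →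
          2 * |concaveParabola v' b y - concaveParabola v b y| ≤ b * (3 * R) ^ 2 := by
        intro y h1 h2
        have h3 := pow_le_pow_left₀ (norm_nonneg _) h1 2
        have h4 := pow_le_pow_left₀ (norm_nonneg _) h2 2
        have h5 : 0 ≤ ‖y.1 - v.1‖ ^ 2 := by positivity
        have h6 : 0 ≤ ‖y.1 - v'.1‖ ^ 2 := by positivity
        have h7 : concaveParabola v' b y - concaveParabola v b y =
            b * ((‖y.1 - v.1‖ ^ 2 - ‖y.1 - v'.1‖ ^ 2) / 2 + (v.2 - v'.2)) := by
          simp only [concaveParabola]; ring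
        have h8 : |(‖y.1 - v.1‖ ^ 2 - ‖y.1 - v'.1‖ ^ 2) / 2 + (v.2 - v'.2)| ≤ 9 / 2 * R ^ 2 := by
          have := hv.2.1
          have := hv.2.2
          have := hv'.2.1
          have := hv'.2.2
          rw [abs_le]
          constructor <;> linarith
        rw [h7, abs_mul, abs_of_pos hb]
        calc 2 * (b * _) ≤ 2 * (b * (9 / 2 * R ^ 2)) := by gcongr
          _ = b * (3 * R) ^ 2 := by ring
      have hw : ∀ v ∈ V, -1 < (c v).2 - (3 * R) ^ 2 := fun v hv => by
        have := (hcs v hv).1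
        have e : (3 * R) ^ 2 = 9 * R ^ 2 := by ring
        linarith
      have hcb : ∀ v ∈ V, Metric.closedBall (c v).1 (3 * R) ⊆ Metric.ball 0 1 := fun v hv =>
        hball _ _ (by have := hcz v hv; linarith)
      have hv1 := hcn v hv
      have hv2 := hcn v' hv'
      have key := hu.vertex_sub_le hlam hlam1 hLam hF hc (m := m) (v₀ := v₀) (v := v) (v' := v')
        (p := c v) (p' := c v') ha hab hδ hr (ρ := 3 * R)
        (by rw [le_div_iff₀ (by positivity)] at hr₀; linarith)
        (hcb v hv) (hw v hv) ((hcs v hv).2.trans hs0)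
        (hcb v' hv') (hw v' hv') ((hcs v' hv').2.trans hs0) (htouch v hv) (htouch v' hv')
        (by linarith)
        (hdiff _ (by linarith) (by
          have := norm_sub_le_norm_sub_add_norm_sub (c v).1 v.1 v'.1
          rw [norm_sub_rev v.1] at this
          linarith))
        (hdiff _ (by
          have := norm_sub_le_norm_sub_add_norm_sub (c v').1 v'.1 v.1
          linarith) (by linarith)) hx ht
      refine ⟨key.1, le_trans (le_of_eq ?_) key.2⟩
      congr 1
      ring)
  have hVvol : volume V = ENNReal.ofReal ((R / 2) ^ n * (R ^ 2 / 4)) *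
      volume (Metric.ball (0 : Space n) 1) := by
    rw [hV, Measure.volume_eq_prod, Measure.prod_prod,
      Measure.addHaar_closedBall _ _ (by positivity), finrank_euclideanSpace_fin, Real.volume_Icc,
      ENNReal.ofReal_mul (by positivity)]
    have : s - R ^ 2 / 4 - (s - R ^ 2 / 2) = R ^ 2 / 4 := by ring
    rw [this]
    ring
  rw [hVvol, mul_right_comm] at hvol
  exact (ENNReal.mul_le_mul_iff_left (Metric.measure_ball_pos _ _ one_pos).ne'
    measure_ball_lt_top.ne).1 hvol

theorem bddBelow_image_Q1 {n : ℕ} {u : Space n × ℝ → ℝ}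
    (h : ∃ B : ℝ, ∀ x ∈ Metric.closedBall (0 : Space n) 1, ∀ t : ℝ, |u (x, t)| ≤ B) :
    BddBelow (u '' Q1 n) := by
  obtain ⟨B, hB⟩ := h
  refine ⟨-B, ?_⟩
  rintro _ ⟨q, hq, rfl⟩
  exact (abs_le.1 (hB q.1 (Metric.ball_subset_closedBall hq.1) q.2)).1

set_option maxHeartbeats 1000000 in
theorem proposition3p1 (n : ℕ) (hn : 1 ≤ n) (lam Lam : ℝ) (hlam : 0 < lam) (hlam1 : lam ≤ 1)
    (hLam : 1 ≤ Lam) :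
    ∃ c₁ : ℝ, 0 < c₁ ∧
      ∀ (δ : ℝ), 0 < δ →
      ∀ (F : Matrix (Fin n) (Fin n) ℝ → ℝ), EllipticNearZero lam Lam δ F →
      ∀ (u : Space n × ℝ → ℝ),
        ContinuousOn u (Metric.closedBall (0 : Space n) 1 ×ˢ (Set.univ : Set ℝ)) →
        (∃ B : ℝ, ∀ x ∈ Metric.closedBall (0 : Space n) 1, ∀ t : ℝ, |u (x, t)| ≤ B) →
        LocallyUniformlySemiconcave u →
        IsViscositySupersolution F u →
      ∀ (θ : ℝ), 3 / 4 ≤ θ → θ ≤ 4 →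
      ∀ (x₀ : Space n) (t₀ T₀ : ℝ), 0 < T₀ → backwardPB θ T₀ x₀ t₀ ⊆ Q1 n →
      ∀ (a : ℝ), 0 < a → a < c0 n lam Lam * δ →
      ∀ (x₁ : Space n) (t₁ T₁ : ℝ), 0 < T₁ → (x₁, t₁) ∈ backwardPB θ T₀ x₀ t₀ →
        ((forwardPB θ T₁ x₁ t₁ ∩ {p : Space n × ℝ | p.2 = t₁ + T₁}) ∩
          (contactSet a (closure (Q1 n)) u ∩ backwardPB θ T₀ x₀ t₀)).Nonempty →
        ENNReal.ofReal c₁ * volume (forwardPB θ T₁ x₁ t₁) ≤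
          volume (contactSet (c₁⁻¹ * a) (closure (Q1 n)) u ∩ backwardPB θ T₀ x₀ t₀ ∩
            forwardPB θ T₁ x₁ t₁) := by
  have hLam0 : 0 < Lam := by linarith
  have hn0 : (0 : ℝ) < n := by exact_mod_cast hn
  set g := Real.exp (700000 * Lam ^ 2 / lam) * (1 + Lam) / lam with hg
  have hgpos : 0 < g := by positivity
  have hg1 : 1 ≤ g := by
    rw [hg, le_div_iff₀ hlam, one_mul]
    have h1 : 1 ≤ Real.exp (700000 * Lam ^ 2 / lam) := Real.one_le_exp (by positivity)
    nlinarith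
  set C := (512 * Lam / lam * √n) ^ n * (4 * (1033 * Lam / lam * n)) with hC
  have hCpos : 0 < C := by positivity
  set ω := volume.real (Metric.ball (0 : Space n) 1) with hω
  have hωpos : 0 < ω := ENNReal.toReal_pos (Metric.measure_ball_pos _ _ one_pos).ne'
    measure_ball_lt_top.ne
  have hωe : volume (Metric.ball (0 : Space n) 1) = ENNReal.ofReal ω :=
    (ENNReal.ofReal_toReal measure_ball_lt_top.ne).symm
  -- Ratio of scales: `√(T₁ / θ) = 256 * (R / 2)` and `T₁ ≤ 65536 * R ^ 2 = 262144 * (R ^ 2 / 4)`.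
  set κ := 1 / (256 ^ n * 262144 * ω * C) with hκ
  have hκpos : 0 < κ := by positivity
  set c₁ := min (1 / (1 + 8 * g)) κ with hc₁
  have hc₁pos : 0 < c₁ := lt_min (by positivity) hκpos
  have hc₁inv : 1 + 8 * g ≤ c₁⁻¹ := by
    rw [le_inv_comm₀ (by positivity) hc₁pos, ← one_div]
    exact min_le_left _ _
  refine ⟨c₁, hc₁pos, ?_⟩
  intro δ hδ F hF u hc hbdd _ hu θ hθ1 hθ2 x₀ t₀ T₀ _ hQ a ha hac x₁ t₁ T₁ hT₁ hx₁ ⟨p, hp⟩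
  obtain ⟨x, t⟩ := p
  obtain ⟨⟨hpf, hpt⟩, ⟨-, v₀, hv₀, hlt, heq⟩, hpb⟩ := hp
  simp only [mem_ofPred_eq] at hpt
  subst hpt
  have hθ : 0 < θ := by linarith
  obtain ⟨z₀, y, e, hcyl, hslice, hz₀e, hye, hxy, hyz⟩ :=
    exists_tube_and_window hθ hT₁ hx₁ hpf hpb
  have hcl : closure (Q1 n) = Metric.closedBall 0 1 ×ˢ Icc (-1) 0 := by
    rw [Q1, closure_prod_eq, closure_ball _ one_ne_zero, closure_Ioc (by norm_num)]
  rw [hcl] at hv₀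
  have hbd := bddBelow_image_Q1 hbdd
  set m := sInf (u '' Q1 n) with hm
  have hlt' : ∀ ξ ∈ Metric.ball (0 : Space n) 1, ∀ τ < t₁ + T₁,
      m + concaveParabola v₀ a (ξ, τ) < u (ξ, τ) := fun ξ hξ τ hτ => by
    have := hlt ξ hξ τ hτ
    linarith
  have hle := le_of_forall_lt_before hc (continuous_const.add
    (contDiff_concaveParabola (k := 0) v₀ a).continuous) hlt'
  set ρ := √(T₁ / θ) with hρ
  have hρ0 : 0 < ρ := by positivity
  have hρ2 : θ * ρ ^ 2 = T₁ := by rw [hρ, Real.sq_sqrt (by positivity)]; field_simp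
  set R := ρ / 128 with hR
  have hR0 : 0 < R := by positivity
  have hρR : ρ = 128 * R := by rw [hR]; ring
  have hTR : T₁ = 16384 * θ * R ^ 2 := by rw [← hρ2, hρR]; ring
  have hR2 : 0 < R ^ 2 := by positivity
  have hT1 : 12288 * R ^ 2 ≤ T₁ := by rw [hTR]; nlinarith
  have hT2 : T₁ ≤ 65536 * R ^ 2 := by rw [hTR]; nlinarith
  have hball : Metric.closedBall x₀ e ⊆ Metric.ball 0 1 := fun w hw =>
    (hQ (hslice (a := (w, t₁)) ⟨hw, rfl⟩)).1
  set s := t₁ + 3 * T₁ / 8 with hs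
  have hst : t₁ + T₁ - s = 5 * T₁ / 8 := by rw [hs]; ring
  -- The velocity that carries the bump from `z₀` at time `s` to `y` at the final time `t₁ + T₁`.
  set d : Space n := (5 * T₁ / 8)⁻¹ • (y - z₀) with hd
  have hdend : z₀ + (t₁ + T₁ - s) • d = y := by
    rw [hst, hd, smul_smul, mul_inv_cancel₀ (by positivity), one_smul, add_sub_cancel]
  have hdn : R * ‖d‖ ≤ 1 := by
    rw [hd, norm_smul, Real.norm_of_nonneg (by positivity), ← mul_assoc, mul_comm R, mul_assoc,
      inv_mul_le_iff₀ (by positivity), mul_one]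
    have : R * ‖y - z₀‖ ≤ R * (2 * ρ) := by gcongr
    rw [hρR] at this
    nlinarith
  obtain ⟨z, hz, hzu⟩ := hu.exists_le_concaveParabola_add hlam hlam1 hLam hF hc (m := m)
    (v := v₀) (E := 700000 * Lam ^ 2 / lam) (c := z₀) (d := d) (x := x) (R := R) (s := s)
    (t := t₁ + T₁) ha hR0 (by linarith) (by have := (hQ hx₁).2.1; simp only at this; linarith)
    (hQ hpb).2.2 (by
      intro τ hτ w hw
      refine hball (mem_closedBall_iff_norm.2 ?_)
      rw [mem_closedBall_iff_norm] at hw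
      set l := (5 * T₁ / 8)⁻¹ * (τ - s) with hl
      have hl0 : 0 ≤ l := mul_nonneg (by positivity) (sub_nonneg.2 hτ.1)
      have hl1 : l ≤ 1 := by
        rw [hl, inv_mul_le_iff₀ (by positivity)]
        have := hτ.2
        linarith
      have h1 : z₀ + (τ - s) • d - x₀ = (1 - l) • (z₀ - x₀) + l • (y - x₀) := by
        rw [hd, smul_smul, mul_comm (τ - s), ← hl]; module
      have h2 : ‖z₀ + (τ - s) • d - x₀‖ ≤ (1 - l) * ‖z₀ - x₀‖ + l * ‖y - x₀‖ := by
        rw [h1]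
        refine (norm_add_le _ _).trans (le_of_eq ?_)
        rw [norm_smul, norm_smul, Real.norm_of_nonneg (sub_nonneg.2 hl1), Real.norm_of_nonneg hl0]
      have h3 : (1 - l) * ‖z₀ - x₀‖ + l * ‖y - x₀‖ ≤ (1 - l) * (e - R) + l * (e - R) := by
        have := sub_nonneg.2 hl1
        gcongr <;> linarith
      have h4 := norm_sub_le_norm_sub_add_norm_sub w (z₀ + (τ - s) • d) x₀
      linarith)
    (fun ξ hξ τ hτ => hle ξ hξ τ hτ.2) (by rw [hdend]; exact hxy) (by linarith) hdn (by
      rw [hst]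
      calc 16 * Lam ^ 2 / lam / R ^ 2 * (5 * T₁ / 8)
          ≤ 16 * Lam ^ 2 / lam / R ^ 2 * (5 * (65536 * R ^ 2) / 8) := by gcongr
        _ = 655360 * Lam ^ 2 / lam := by field_simp; norm_num
        _ ≤ 700000 * Lam ^ 2 / lam := by gcongr; norm_num) (by
      have h1 := opening_le_of_lt_c0_mul hn hlam hlam1 hLam hδ hac
      rw [← hg] at h1 ⊢
      refine le_trans ?_ h1
      rw [le_div_iff₀ hlam]
      have h2 : 0 < 8 * (g * a) := by positivity
      nlinarith [mul_le_mul_of_nonneg_left (hlam1.trans hLam) h2.le])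
  rw [← hg] at hzu
  -- With `b = 8 * g * a` the gap `b / 8 * R ^ 2` is the one left by the barrier, and `a + b = (1 +
  -- 8 * g) * a ≤ c₁⁻¹ * a`.
  have hmain := hu.le_volume_contactSet hn hlam hlam1 hLam hF hc hbd (a := a) (b := 8 * (g * a))
    (a' := c₁⁻¹ * a) (R := R) (s := s) (t := t₁ + T₁) (σ := t₁ + T₁ / 4) (v₀ := v₀) (z := z)
    (z₀ := z₀) (G := backwardPB θ T₀ x₀ t₀ ∩ forwardPB θ T₁ x₁ t₁) ha (by nlinarith)
    (by nlinarith) (opening_le_of_lt_c0_mul hn hlam hlam1 hLam hδ hac) hR0 (by linarith)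
    hv₀.1 hv₀.2.1 hlt' (inter_subset_left.trans hQ) hcyl (by linarith) hz
    (by refine hzu.trans (le_of_eq ?_); ring)
  rw [inter_assoc]
  set A := contactSet (c₁⁻¹ * a) (closure (Q1 n)) u ∩
    (backwardPB θ T₀ x₀ t₀ ∩ forwardPB θ T₁ x₁ t₁) with hA
  rw [← hC] at hmain
  calc ENNReal.ofReal c₁ * volume (forwardPB θ T₁ x₁ t₁)
      ≤ ENNReal.ofReal c₁ * (ENNReal.ofReal (ρ ^ n * T₁) * ENNReal.ofReal ω) := by
        gcongr
        rw [← hωe]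
        exact volume_forwardPB_le hθ hT₁
    _ = ENNReal.ofReal (c₁ * (ρ ^ n * T₁ * ω)) := by
        rw [← ENNReal.ofReal_mul (by positivity), ← ENNReal.ofReal_mul hc₁pos.le]
    _ ≤ ENNReal.ofReal (C⁻¹ * ((R / 2) ^ n * (R ^ 2 / 4))) := by
        refine ENNReal.ofReal_le_ofReal ?_
        calc c₁ * (ρ ^ n * T₁ * ω) ≤ κ * (ρ ^ n * (65536 * R ^ 2) * ω) := by
              gcongr
              exact min_le_right _ _
          _ = C⁻¹ * ((R / 2) ^ n * (R ^ 2 / 4)) := by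
              have h1 : ρ ^ n = 256 ^ n * (R / 2) ^ n := by
                rw [← mul_pow, hρR]; congr 1; ring
              rw [hκ, h1]
              field_simp
              norm_num
    _ = ENNReal.ofReal C⁻¹ * ENNReal.ofReal ((R / 2) ^ n * (R ^ 2 / 4)) :=
        ENNReal.ofReal_mul (by positivity)
    _ ≤ ENNReal.ofReal C⁻¹ * (ENNReal.ofReal C * volume A) := by gcongr
    _ = volume A := by
        rw [← mul_assoc, ← ENNReal.ofReal_mul (by positivity), inv_mul_cancel₀ hCpos.ne',
          ENNReal.ofReal_one, one_mul]
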